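/- For an integer $N\ge 1$ and real $\xi$, let $\lambda_N(\xi)\in[0,\infty]$ be the supremum of the real numbers $\lambda$ such that the system \[ 1\le |x|\le X,\qquad \max_{1\le j\le N}|\xi^{j}x-y_j|\le X^{-\lambda} \] has a solution $(x,y_1,\dots,y_N)\in\mathbb Z^{N+1}$ for arbitrarily large real $X$, and let $\widehat\lambda_N(\xi)\in[0,\infty]$ be the supremum of the real $\lambda$ such that it has a solution for all sufficiently large $X$. Theorem. Let $k\ge n\ge 1$ be integers and let $\xi$ be a real number. If $\lambda_n(\xi)=\infty$ (for instance if $\xi$ is rational), then $\lambda_k(\xi)=\infty$. If $\lambda_n(\xi)<\infty$, then $\widehat\lambda_n(\xi)$ and $\lambda_k(\xi)$ are finite too, and the following hold. (a) If $n\ge 2$, then \[ \lambda_k(\xi)\ \ge\ \frac{(n-1)\lambda_n(\xi)+(k-n)\widehat\lambda_n(\xi)+n-k}{(n-k)\widehat\lambda_n(\xi)+k-1} \] and \[ \lambda_k(\xi)\ \ge\ \frac{(n-1)\lambda_n(\xi)+(k-1)\widehat\lambda_n(\xi)+n-k}{(n-1)\lambda_n(\xi)-(k-1)\widehat\lambda_n(\xi)+n+k-2},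 \] where both denominators are positive. (b) If $n\ge1$ and $\widehat\lambda_n(\xi)=1/n$, then \[ \lambda_k(\xi)\ \ge\ \frac{n\lambda_n(\xi)+n-k}{k}, \] which for $n\ge 2$ is what the first bound of (a) becomes. If $n=1$, then always $\widehat\lambda_1(\xi)=1$, so that the two quotients in (a) have the form $0/0$ and the bound of (b) takes the place of the first one. -/

import Mathlib

open Filter

/-- There are an integer `x` and an integer vector `y` with
`1 ≤ |x| ≤ X`, `max_j |ξ_j x - y_j| ≤ X ^ (-lam)`. -/
def SimApproxSolvable {N : ℕ} (ξ : Fin N → ℝ) (lam X : ℝ) : Prop :=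
  ∃ (x : ℤ) (y : Fin N → ℤ), 1 ≤ |(x : ℝ)| ∧ |(x : ℝ)| ≤ X ∧
    ∀ j, |ξ j * (x : ℝ) - (y j : ℝ)| ≤ X ^ (-lam)

/-- Ordinary exponent of simultaneous approximation of a vector: the supremum, in the extended
reals, of the real `lam` such that the system is solvable for arbitrarily large `X`. -/
noncomputable def simExponent {N : ℕ} (ξ : Fin N → ℝ) : EReal :=
  ⨆ lam ∈ {lam : ℝ | ∃ᶠ X : ℝ in atTop, SimApproxSolvable ξ lam X}, (lam : EReal)

/-- Uniform exponent of simultaneous approximation of a vector: the supremum, in the extended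
reals, of the real `lam` such that the system is solvable for all sufficiently large `X`. -/
noncomputable def uniformSimExponent {N : ℕ} (ξ : Fin N → ℝ) : EReal :=
  ⨆ lam ∈ {lam : ℝ | ∀ᶠ X : ℝ in atTop, SimApproxSolvable ξ lam X}, (lam : EReal)

/-- The point `(ξ, ξ², …, ξᴺ)` of the Veronese curve. -/
def veronese (N : ℕ) (ξ : ℝ) : Fin N → ℝ := fun j => ξ ^ ((j : ℕ) + 1)

/-- `λ_N(ξ)`. -/
noncomputable def lambdaExp (N : ℕ) (ξ : ℝ) : EReal := simExponent (veronese N ξ)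

/-- `λ̂_N(ξ)`. -/
noncomputable def lambdaHatExp (N : ℕ) (ξ : ℝ) : EReal := uniformSimExponent (veronese N ξ)

/-! Suppose v_j is close to xξ^j for j ≤ N. For an integer t with |ξ - t| ≥ 1, a solution of w_{j+1}
= t w_j + v_j is close to (x/(ξ - t))ξ^j for j ≤ N + 1, provided that the free summand c t^j is
chosen well. It is fixed by requiring that an integer polynomial p of degree at most n, very small
at ξ, annihilate w. Each step gains one coordinate without enlarging x, and the error grows by
constant factors and a term controlled by p(ξ).

The price is integrality. The only denominator is q = p(t), so m = k - n steps impose m successive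
congruences modulo q, and among more than |q|^m integer combinations of known approximations two
have a difference that satisfies them all (`exists_int_extension`). The extension is nonzero because
v can be recovered from w. By a Vandermonde argument t can be chosen in a fixed finite set so that
|q| is comparable to the height of p (`exists_int_eval_large`).

It remains to supply p of small height. Take an approximation z with Y = |z_0| and error Y^(-λ), and
an independent z' with |z'_0| ≤ Y and error of order Y^(-μ), μ just below the uniform exponent. The
minors z'_0 z_j - z_0 z'_j have size O(Y^(1-μ)), and a pigeonhole argument of Siegel type gives p
annihilating z of height O(Y^η), η = (1-μ)/(n-1); then p(ξ) = O(|q| Y^(-λ-1)). Extending multiples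
of z alone gives the first bound, a balanced box of combinations of z and z' the second. For n = 1
the polynomial z_1 - z_0 T, of height O(Y), takes the place of p. -/

/-! ### Extension of sequences and its integrality -/

/-- The solution `s` of `s 0 = 0`, `s (j + 1) = t * s j + v j`. -/
def shiftSum (t : ℤ) (v : ℕ → ℝ) : ℕ → ℝ
  | 0 => 0
  | j + 1 => t * shiftSum t v j + v j

/-- Evaluation at `v` of the linear functional with integer coefficients `p 0, …, p n`. -/
noncomputable def coeffPair (n : ℕ) (p : ℕ → ℤ) (v : ℕ → ℝ) : ℝ :=
  ∑ i ∈ Finset.range (n + 1), (p i : ℝ) * v i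

/-- The sequence `w` with `w (j + 1) = t * w j + v j` that is annihilated by `p`. -/
noncomputable def polyExt (n : ℕ) (p : ℕ → ℤ) (t : ℤ) (v : ℕ → ℝ) : ℕ → ℝ := fun j =>
  shiftSum t v j - (t : ℝ) ^ j *
    (coeffPair n p (shiftSum t v) / coeffPair n p (fun i => (t : ℝ) ^ i))

lemma coeffPair_sub (n : ℕ) (p : ℕ → ℤ) (v w : ℕ → ℝ) :
    coeffPair n p (v - w) = coeffPair n p v - coeffPair n p w := by
  simp [coeffPair, mul_sub, Finset.sum_sub_distrib]

lemma coeffPair_mul_left (n : ℕ) (p : ℕ → ℤ) (c : ℝ) (v : ℕ → ℝ) :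
    coeffPair n p (fun i => c * v i) = c * coeffPair n p v := by
  simp only [coeffPair, Finset.mul_sum]
  exact Finset.sum_congr rfl fun i _ => by ring

lemma abs_coeffPair_le {n : ℕ} {p : ℕ → ℤ} {v : ℕ → ℝ} {A B : ℝ} (hA : 0 ≤ A)
    (hp : ∀ j ≤ n, |(p j : ℝ)| ≤ A) (hv : ∀ j ≤ n, |v j| ≤ B) :
    |coeffPair n p v| ≤ (n + 1) * (A * B) := by
  unfold coeffPair
  refine (Finset.abs_sum_le_sum_abs _ _).trans ?_
  have : ∀ i ∈ Finset.range (n + 1), |(p i : ℝ) * v i| ≤ A * B := fun i hi => by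
    rw [Finset.mem_range] at hi
    rw [abs_mul]
    exact mul_le_mul (hp i (by omega)) (hv i (by omega)) (abs_nonneg _) hA
  simpa using Finset.sum_le_card_nsmul _ _ _ this

lemma shiftSum_sub (t : ℤ) (v w : ℕ → ℝ) :
    shiftSum t (v - w) = shiftSum t v - shiftSum t w := by
  ext j
  induction j with
  | zero => simp [shiftSum]
  | succ j ih => simp only [shiftSum, ih, Pi.sub_apply]; ring

lemma polyExt_sub (n : ℕ) (p : ℕ → ℤ) (t : ℤ) (v w : ℕ → ℝ) :
    polyExt n p t (v - w) = polyExt n p t v - polyExt n p t w := by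
  ext j
  simp only [polyExt, shiftSum_sub, coeffPair_sub, Pi.sub_apply]
  ring

lemma polyExt_succ (n : ℕ) (p : ℕ → ℤ) (t : ℤ) (v : ℕ → ℝ) (j : ℕ) :
    polyExt n p t v (j + 1) = t * polyExt n p t v j + v j := by
  simp only [polyExt, shiftSum]
  ring

lemma coeffPair_polyExt {n : ℕ} {p : ℕ → ℤ} {t : ℤ}
    (ht : coeffPair n p (fun i => (t : ℝ) ^ i) ≠ 0) (v : ℕ → ℝ) :
    coeffPair n p (polyExt n p t v) = 0 := by
  have : polyExt n p t v = shiftSum t v - fun i =>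
      (coeffPair n p (shiftSum t v) / coeffPair n p (fun i => (t : ℝ) ^ i)) * (t : ℝ) ^ i := by
    ext j
    simp only [polyExt, Pi.sub_apply]
    ring
  rw [this, coeffPair_sub, coeffPair_mul_left, div_mul_cancel₀ _ ht, sub_self]

/-- All terms of the sequence are integers. -/
def IntegerValued (v : ℕ → ℝ) : Prop := ∀ j, ∃ a : ℤ, v j = a

lemma IntegerValued.sub {v w : ℕ → ℝ} (hv : IntegerValued v) (hw : IntegerValued w) :
    IntegerValued (v - w) := fun j => by
  obtain ⟨a, ha⟩ := hv j
  obtain ⟨b, hb⟩ := hw j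
  exact ⟨a - b, by simp [ha, hb]⟩

lemma IntegerValued.shiftSum {v : ℕ → ℝ} (hv : IntegerValued v) (t : ℤ) :
    IntegerValued (shiftSum t v) := fun j => by
  induction j with
  | zero => exact ⟨0, by simp [_root_.shiftSum]⟩
  | succ j ih =>
    obtain ⟨a, ha⟩ := ih
    obtain ⟨b, hb⟩ := hv j
    exact ⟨t * a + b, by simp [_root_.shiftSum, ha, hb]⟩

lemma IntegerValued.coeffPair {v : ℕ → ℝ} (hv : IntegerValued v) (n : ℕ) (p : ℕ → ℤ) :
    ∃ a : ℤ, coeffPair n p v = a := by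
  choose a ha using hv
  exact ⟨∑ i ∈ Finset.range (n + 1), p i * a i, by simp [_root_.coeffPair, ha]⟩

/-- The value of `p` at `t` is the only denominator in `polyExt`, so integrality is a single
divisibility, which pigeonholing over residues can enforce. -/
lemma IntegerValued.polyExt {v : ℕ → ℝ} (hv : IntegerValued v) {n : ℕ} {p : ℕ → ℤ} {t c : ℤ}
    (ht : _root_.coeffPair n p (fun i => (t : ℝ) ^ i) ≠ 0)
    (hc : _root_.coeffPair n p (_root_.shiftSum t v) =
      c * _root_.coeffPair n p (fun i => (t : ℝ) ^ i)) :
    IntegerValued (polyExt n p t v) := fun j => by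
  obtain ⟨a, ha⟩ := hv.shiftSum t j
  refine ⟨a - t ^ j * c, ?_⟩
  rw [_root_.polyExt, hc, mul_div_cancel_right₀ _ ht, ha]
  push_cast
  ring

/-- Among sufficiently many integer sequences there are many whose differences have integral
`m`-fold extensions. -/
lemma exists_integerValued_iterate_polyExt {ι : Type*} {n : ℕ} {p : ℕ → ℤ} {t q : ℤ}
    (hq : coeffPair n p (fun i => (t : ℝ) ^ i) = q) (hq0 : q ≠ 0) (f : ι → ℕ → ℝ)
    (hf : ∀ i, IntegerValued (f i)) (A : Finset ι) (m : ℕ) :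
    ∀ r : ℕ, q.natAbs ^ m * r < A.card → ∃ A' ⊆ A, r < A'.card ∧
      ∀ a ∈ A', ∀ b ∈ A', IntegerValued ((polyExt n p t)^[m] (f a - f b)) := by
  have hqR : coeffPair n p (fun i => (t : ℝ) ^ i) ≠ 0 := by rw [hq]; exact_mod_cast hq0
  induction m with
  | zero =>
    intro r hr
    exact ⟨A, subset_rfl, by simpa using hr, fun a _ b _ => (hf a).sub (hf b)⟩
  | succ m ih =>
    intro r hr
    obtain ⟨A', hA', hcard, hint⟩ := ih (q.natAbs * r) (by rw [← mul_assoc, ← pow_succ]; exact hr)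
    -- Only differences are known to have integral `m`-fold extensions, so residues are taken
    -- relative to a base point, which cancels in `D a - D b`.
    obtain ⟨a₀, ha₀⟩ : A'.Nonempty := Finset.card_pos.mp (by omega)
    set D : ι → ℝ := fun a =>
      coeffPair n p (shiftSum t ((polyExt n p t)^[m] (f a - f a₀))) with hD
    have hDint : ∀ a ∈ A', ∃ c : ℤ, D a = c := fun a ha =>
      ((hint a ha a₀ ha₀).shiftSum t).coeffPair n p
    set κ : ι → ℤ := fun a => ⌊D a⌋ % q with hκ
    have hmaps : ∀ a ∈ A', κ a ∈ Finset.Ico (0 : ℤ) q.natAbs := fun a _ => by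
      rw [Finset.mem_Ico]
      exact ⟨Int.emod_nonneg _ hq0, by simpa using Int.emod_lt_abs _ hq0⟩
    obtain ⟨y, -, hy⟩ := Finset.exists_lt_card_fiber_of_mul_lt_card_of_maps_to hmaps
      (n := r) (by simpa only [Int.card_Ico, sub_zero, Int.toNat_natCast] using hcard)
    refine ⟨_, (Finset.filter_subset _ _).trans hA', hy, fun a ha b hb => ?_⟩
    rw [Finset.mem_filter] at ha hb
    have hsub : ∀ l, ∀ u w : ℕ → ℝ, (polyExt n p t)^[l] (u - w) =
        (polyExt n p t)^[l] u - (polyExt n p t)^[l] w := fun l => by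
      induction l with
      | zero => simp
      | succ l ihl => intro u w; simp only [Function.iterate_succ_apply', ihl, polyExt_sub]
    rw [Function.iterate_succ_apply']
    have hdiff : coeffPair n p (shiftSum t ((polyExt n p t)^[m] (f a - f b))) = D a - D b := by
      rw [hD]
      simp only [hsub, shiftSum_sub, coeffPair_sub]
      ring
    obtain ⟨ca, hca⟩ := hDint a ha.1
    obtain ⟨cb, hcb⟩ := hDint b hb.1
    have hmod : ca % q = cb % q := by
      have h := ha.2.trans hb.2.symm
      simpa [hκ, hca, hcb] using h
    obtain ⟨c, hc⟩ : q ∣ ca - cb := Int.ModEq.dvd (show cb % q = ca % q from hmod.symm)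
    refine (hint a ha.1 b hb.1).polyExt (c := c) hqR ?_
    rw [hdiff, hca, hcb, hq]
    have : ((ca - cb : ℤ) : ℝ) = ((q * c : ℤ) : ℝ) := by rw [hc]
    push_cast at this
    linarith

/-! ### Error estimates for extensions -/

lemma abs_shiftSum_le {t : ℤ} {τ : ℝ} (ht : |(t : ℝ)| ≤ τ) {e : ℕ → ℝ} {ε : ℝ} {N : ℕ}
    (he : ∀ j ≤ N, |e j| ≤ ε) : ∀ j ≤ N + 1, |shiftSum t e j| ≤ j * (1 + τ) ^ j * ε := by
  have hε : 0 ≤ ε := (abs_nonneg _).trans (he 0 (by omega))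
  have hτ : 0 ≤ τ := (abs_nonneg _).trans ht
  intro j hj
  induction j with
  | zero => simp [shiftSum]
  | succ j ih =>
    rw [shiftSum]
    have h1 : |(t : ℝ) * shiftSum t e j| ≤ τ * (j * (1 + τ) ^ j * ε) := by
      rw [abs_mul]
      exact mul_le_mul ht (ih (by omega)) (abs_nonneg _) hτ
    have h2 := he j (by omega)
    have h3 : (1 : ℝ) ≤ (1 + τ) ^ (j + 1) := one_le_pow₀ (by linarith)
    have h4 : 0 ≤ j * (1 + τ) ^ j * ε := by positivity
    have h5 : ε ≤ (1 + τ) ^ (j + 1) * ε := le_mul_of_one_le_left hε h3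
    calc |(t : ℝ) * shiftSum t e j + e j| ≤ τ * (j * (1 + τ) ^ j * ε) + ε :=
          (abs_add_le _ _).trans (add_le_add h1 h2)
      _ ≤ (1 + τ) * (j * (1 + τ) ^ j * ε) + (1 + τ) ^ (j + 1) * ε := by nlinarith
      _ = _ := by push_cast; ring

/-- One extension step preserves closeness to a geometric progression. -/
lemma abs_polyExt_sub_le {n N : ℕ} (hnN : n ≤ N + 1) {ξ τ K δ ε x : ℝ} {p : ℕ → ℤ} {t : ℤ}
    (ht : |(t : ℝ)| ≤ τ) (hξt : 1 ≤ |ξ - t|) (hK : 0 ≤ K)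
    (hp : ∀ j ≤ n, |(p j : ℝ)| ≤ K * |coeffPair n p (fun i => (t : ℝ) ^ i)|)
    (hP : coeffPair n p (fun i => (t : ℝ) ^ i) ≠ 0)
    (hδ : |coeffPair n p (fun i => ξ ^ i)| ≤ δ * |coeffPair n p (fun i => (t : ℝ) ^ i)|)
    {v : ℕ → ℝ} (hv : ∀ j ≤ N, |v j - x * ξ ^ j| ≤ ε) :
    ∀ j ≤ N + 1, |polyExt n p t v j - x / (ξ - t) * ξ ^ j| ≤
      (1 + τ) ^ (N + 1) * (1 + (N + 1) * (1 + τ) ^ (N + 1) * (1 + (n + 1) * K)) *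
        (ε + δ * |x|) := by
  set Q := coeffPair n p (fun i => (t : ℝ) ^ i) with hQ
  have hQpos : 0 < |Q| := abs_pos.mpr hP
  have hε : 0 ≤ ε := (abs_nonneg _).trans (hv 0 (by omega))
  have hτ : 0 ≤ τ := (abs_nonneg _).trans ht
  have hδ0 : 0 ≤ δ := by
    have := (abs_nonneg _).trans hδ
    exact nonneg_of_mul_nonneg_left this hQpos
  have hω : ξ - t ≠ 0 := fun h => by rw [h] at hξt; norm_num at hξt
  set e : ℕ → ℝ := fun j => v j - x * ξ ^ j with he
  set e' : ℕ → ℝ := fun j => polyExt n p t v j - x / (ξ - t) * ξ ^ j with he'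
  -- The progression with factor `x / (ξ - t)` solves the recurrence with input `x * ξ ^ j`. Hence
  -- the errors satisfy it too, and only the initial error `e' 0` is still unknown.
  have hsucc : ∀ j, e' (j + 1) = t * e' j + e j := fun j => by
    simp only [he', he, polyExt_succ]
    field_simp
    ring
  have hexp : ∀ j, e' j = (t : ℝ) ^ j * e' 0 + shiftSum t e j := fun j => by
    induction j with
    | zero => simp [shiftSum]
    | succ j ih => rw [hsucc, ih, shiftSum]; ring
  have hB1 : (1 : ℝ) ≤ (1 + τ) ^ (N + 1) := one_le_pow₀ (by linarith)
  set B := (1 + τ) ^ (N + 1) with hB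
  have hs : ∀ j ≤ N + 1, |shiftSum t e j| ≤ (N + 1) * B * ε := fun j hj => by
    refine (abs_shiftSum_le ht hv j hj).trans ?_
    have h1 : (j : ℝ) ≤ N + 1 := by exact_mod_cast hj
    have h2 : (1 + τ) ^ j ≤ B := pow_le_pow_right₀ (by linarith) hj
    gcongr
  -- Since `p` annihilates the extension, pairing the errors with `p` determines `e' 0`. Dividing by
  -- `Q` is harmless because the coefficients of `p` are at most `K * |Q|`.
  have hsum : Q * e' 0 = -(x / (ξ - t) * coeffPair n p (fun i => ξ ^ i)) -
      coeffPair n p (shiftSum t e) := by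
    have h1 : coeffPair n p e' = -(x / (ξ - t) * coeffPair n p (fun i => ξ ^ i)) := by
      have : e' = polyExt n p t v - fun i => x / (ξ - t) * ξ ^ i := rfl
      rw [this, coeffPair_sub, coeffPair_polyExt hP, coeffPair_mul_left]
      ring
    have h2 : coeffPair n p (e' - shiftSum t e) = Q * e' 0 := by
      have : e' - shiftSum t e = fun i => e' 0 * (t : ℝ) ^ i := by
        ext i
        rw [Pi.sub_apply, hexp i]
        ring
      rw [this, coeffPair_mul_left]
      ring
    rw [← h2, coeffPair_sub, h1]
  have hx' : |x / (ξ - t)| ≤ |x| := by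
    rw [abs_div]
    exact div_le_self (abs_nonneg _) hξt
  have he0 : |e' 0| ≤ δ * |x| + (n + 1) * (K * ((N + 1) * B * ε)) := by
    have h1 : |Q| * |e' 0| ≤ |x| * (δ * |Q|) + (n + 1) * ((K * |Q|) * ((N + 1) * B * ε)) := by
      rw [← abs_mul, hsum]
      refine (abs_sub _ _).trans (add_le_add ?_ ?_)
      · rw [abs_neg, abs_mul]
        exact mul_le_mul hx' hδ (abs_nonneg _) (abs_nonneg _)
      · exact abs_coeffPair_le (by positivity) hp fun j hj => hs j (by omega)
    refine le_of_mul_le_mul_left (h1.trans (le_of_eq ?_)) hQpos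
    ring
  intro j hj
  have h1 : |(t : ℝ) ^ j * e' 0| ≤ B * (δ * |x| + (n + 1) * (K * ((N + 1) * B * ε))) := by
    rw [abs_mul, abs_pow]
    refine mul_le_mul ?_ he0 (abs_nonneg _) (by positivity)
    exact (pow_le_pow_left₀ (abs_nonneg _) (by linarith : |(t : ℝ)| ≤ 1 + τ) j).trans
      (pow_le_pow_right₀ (by linarith) hj)
  change |e' j| ≤ _
  rw [hexp j]
  refine (abs_add_le _ _).trans ((add_le_add h1 (hs j hj)).trans ?_)
  have hdx : 0 ≤ δ * |x| := by positivity
  have e1 : B * (1 + (N + 1) * B * (1 + (n + 1) * K)) * (ε + δ * |x|) -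
      (B * (δ * |x| + (n + 1) * (K * ((N + 1) * B * ε))) + (N + 1) * B * ε) =
      B * ε + B * ((N + 1) * B * (1 + (n + 1) * K)) * (δ * |x|) +
        (N + 1) * B * ε * (B - 1) := by ring
  have e2 : 0 ≤ (N + 1) * B * ε * (B - 1) := mul_nonneg (by positivity) (by linarith)
  have e3 : 0 ≤ B * ε + B * ((N + 1) * B * (1 + (n + 1) * K)) * (δ * |x|) := by positivity
  linarith

/-- Iterated extension steps preserve closeness to a geometric progression. -/
lemma exists_iterate_polyExt_bound (n m : ℕ) (τ K : ℝ) (hτ : 0 ≤ τ) (hK : 0 ≤ K) :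
    ∃ C : ℝ, 1 ≤ C ∧ ∀ (ξ δ ε x : ℝ) (p : ℕ → ℤ) (t : ℤ) (v : ℕ → ℝ),
      |(t : ℝ)| ≤ τ → 1 ≤ |ξ - t| →
      (∀ j ≤ n, |(p j : ℝ)| ≤ K * |coeffPair n p (fun i => (t : ℝ) ^ i)|) →
      coeffPair n p (fun i => (t : ℝ) ^ i) ≠ 0 →
      |coeffPair n p (fun i => ξ ^ i)| ≤ δ * |coeffPair n p (fun i => (t : ℝ) ^ i)| →
      (∀ j ≤ n, |v j - x * ξ ^ j| ≤ ε) →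
      ∃ x' : ℝ, |x'| ≤ |x| ∧
        ∀ j ≤ n + m, |(polyExt n p t)^[m] v j - x' * ξ ^ j| ≤ C * (ε + δ * |x|) := by
  induction m with
  | zero =>
    refine ⟨1, le_rfl, fun ξ δ ε x p t v _ _ _ hP hδ hv => ⟨x, le_rfl, fun j hj => ?_⟩⟩
    have hδ0 : 0 ≤ δ := nonneg_of_mul_nonneg_left ((abs_nonneg _).trans hδ) (abs_pos.mpr hP)
    have : 0 ≤ δ * |x| := by positivity
    rw [Function.iterate_zero, id]
    linarith [hv j hj]
  | succ m ih =>
    obtain ⟨C, hC, h⟩ := ih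
    set D : ℝ := (1 + τ) ^ (n + m + 1) *
      (1 + ((n + m : ℕ) + 1) * (1 + τ) ^ (n + m + 1) * (1 + (n + 1) * K)) with hD
    have hD1 : 1 ≤ D := by
      have h1 : (1 : ℝ) ≤ (1 + τ) ^ (n + m + 1) := one_le_pow₀ (by linarith)
      have h2 : 0 ≤ ((n + m : ℕ) + 1) * (1 + τ) ^ (n + m + 1) * (1 + (n + 1) * K) := by
        positivity
      exact one_le_mul_of_one_le_of_one_le h1 (by linarith)
    refine ⟨D * (C + 1), one_le_mul_of_one_le_of_one_le hD1 (by linarith), ?_⟩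
    intro ξ δ ε x p t v ht hξt hp hP hδ hv
    obtain ⟨x', hx', hb⟩ := h ξ δ ε x p t v ht hξt hp hP hδ hv
    have hδ0 : 0 ≤ δ := nonneg_of_mul_nonneg_left ((abs_nonneg _).trans hδ) (abs_pos.mpr hP)
    have hε : 0 ≤ ε := (abs_nonneg _).trans (hv 0 (by omega))
    refine ⟨x' / (ξ - t), ?_, fun j hj => ?_⟩
    · rw [abs_div]
      exact (div_le_self (abs_nonneg _) hξt).trans hx'
    · rw [Function.iterate_succ_apply']
      refine (abs_polyExt_sub_le (by omega) ht hξt hK hp hP hδ hb j (by omega)).trans ?_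
      have h1 : δ * |x'| ≤ δ * |x| := by gcongr
      have h2 : C * (ε + δ * |x|) + δ * |x'| ≤ (C + 1) * (ε + δ * |x|) := by linarith
      exact (mul_le_mul_of_nonneg_left h2 (by linarith : 0 ≤ D)).trans_eq (by ring)

/-- The recurrence gives `v` back as `w (j + 1) - t * w j`, so each step down loses one index. This
keeps extensions of nonzero points nonzero. -/
lemma eq_zero_of_iterate_polyExt_eq_zero {n : ℕ} {p : ℕ → ℤ} {t : ℤ} {v : ℕ → ℝ} {N : ℕ} (m : ℕ)
    (h : ∀ j ≤ N + m, (polyExt n p t)^[m] v j = 0) : ∀ j ≤ N, v j = 0 := by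
  induction m with
  | zero => simpa using h
  | succ m ih =>
    refine ih fun j hj => ?_
    have h1 := h (j + 1) (by omega)
    have h2 := h j (by omega)
    rw [Function.iterate_succ_apply'] at h1 h2
    rw [polyExt_succ, h2] at h1
    simpa using h1

/-- Integer points near the line spanned by `(1, ξ, …, ξ ^ (n + m))`, obtained from the combinations
of two integer points near the line spanned by `(1, ξ, …, ξ ^ n)`. -/
lemma exists_int_extension (n m : ℕ) (τ K : ℝ) (hτ : 0 ≤ τ) (hK : 0 ≤ K) :
    ∃ C : ℝ, 1 ≤ C ∧ ∀ (ξ δ ε ε' : ℝ) (p : ℕ → ℤ) (t q : ℤ) (z z' : ℕ → ℤ) (S T : ℕ),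
      |(t : ℝ)| ≤ τ → 1 ≤ |ξ - t| →
      (∀ j ≤ n, |(p j : ℝ)| ≤ K * |(q : ℝ)|) →
      coeffPair n p (fun i => (t : ℝ) ^ i) = q → q ≠ 0 →
      |coeffPair n p (fun i => ξ ^ i)| ≤ δ * |(q : ℝ)| →
      (∀ j ≤ n, |(z j : ℝ) - z 0 * ξ ^ j| ≤ ε) →
      (∀ j ≤ n, |(z' j : ℝ) - z' 0 * ξ ^ j| ≤ ε') →
      (∀ α β : ℤ, |α| ≤ S → |β| ≤ T → (∀ j ≤ n, α * z j + β * z' j = 0) → α = 0 ∧ β = 0) →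
      q.natAbs ^ m < (S + 1) * (T + 1) →
      ∃ (v : ℕ → ℤ) (x : ℝ), (∃ j ≤ n + m, v j ≠ 0) ∧
        |x| ≤ S * |(z 0 : ℝ)| + T * |(z' 0 : ℝ)| ∧
        ∀ j ≤ n + m, |(v j : ℝ) - x * ξ ^ j| ≤
          C * (S * ε + T * ε' + δ * (S * |(z 0 : ℝ)| + T * |(z' 0 : ℝ)|)) := by
  obtain ⟨C, hC, hext⟩ := exists_iterate_polyExt_bound n m τ K hτ hK
  refine ⟨C, hC, ?_⟩
  intro ξ δ ε ε' p t q z z' S T ht hξt hp hq hq0 hδ hz hz' hind hcard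
  set f : ℕ × ℕ → ℕ → ℝ := fun a j => a.1 * (z j : ℝ) + a.2 * (z' j : ℝ) with hf
  have hqR : (q : ℝ) ≠ 0 := by exact_mod_cast hq0
  have hδ0 : 0 ≤ δ := nonneg_of_mul_nonneg_left ((abs_nonneg _).trans hδ) (abs_pos.mpr hqR)
  have hε : 0 ≤ ε := (abs_nonneg _).trans (hz 0 (by omega))
  have hε' : 0 ≤ ε' := (abs_nonneg _).trans (hz' 0 (by omega))
  -- With `r = 1` two distinct index pairs survive; their difference supplies the coefficients `α`,
  -- `β`.
  obtain ⟨A', hA', hA'card, hint⟩ := exists_integerValued_iterate_polyExt hq hq0 f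
    (fun a j => ⟨a.1 * z j + a.2 * z' j, by simp [hf]⟩)
    (Finset.range (S + 1) ×ˢ Finset.range (T + 1)) m 1 (by simpa using hcard)
  obtain ⟨a, ha, b, hb, hab⟩ := Finset.one_lt_card.mp hA'card
  have ha' := hA' ha
  have hb' := hA' hb
  rw [Finset.mem_product, Finset.mem_range, Finset.mem_range] at ha' hb'
  set α : ℤ := (a.1 : ℤ) - b.1 with hα
  set β : ℤ := (a.2 : ℤ) - b.2 with hβ
  have hαS : |α| ≤ S := abs_le.mpr ⟨by omega, by omega⟩
  have hβT : |β| ≤ T := abs_le.mpr ⟨by omega, by omega⟩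
  have hαR : |(α : ℝ)| ≤ S := by exact_mod_cast hαS
  have hβR : |(β : ℝ)| ≤ T := by exact_mod_cast hβT
  have hfab : ∀ j, (f a - f b) j = α * (z j : ℝ) + β * (z' j : ℝ) := fun j => by
    simp only [hf, hα, hβ, Pi.sub_apply]
    push_cast
    ring
  obtain ⟨x, hx, hxb⟩ := hext ξ δ (S * ε + T * ε') (α * z 0 + β * z' 0) p t (f a - f b) ht hξt
    (by rw [hq]; exact hp) (by rw [hq]; exact hqR) (by rw [hq]; exact hδ) (fun j hj => by
      rw [hfab]
      calc |(α : ℝ) * z j + β * z' j - (α * z 0 + β * z' 0) * ξ ^ j|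
          = |(α : ℝ) * (z j - z 0 * ξ ^ j) + β * (z' j - z' 0 * ξ ^ j)| := by congr 1; ring
        _ ≤ |(α : ℝ)| * |(z j : ℝ) - z 0 * ξ ^ j| + |(β : ℝ)| * |(z' j : ℝ) - z' 0 * ξ ^ j| := by
            rw [← abs_mul, ← abs_mul]; exact abs_add_le _ _
        _ ≤ S * ε + T * ε' := by
            have := hz j hj
            have := hz' j hj
            gcongr)
  have hx0 : |(α : ℝ) * z 0 + β * z' 0| ≤ S * |(z 0 : ℝ)| + T * |(z' 0 : ℝ)| := by
    refine (abs_add_le _ _).trans ?_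
    rw [abs_mul, abs_mul]
    gcongr
  choose v hv using hint a ha b hb
  refine ⟨v, x, ?_, hx.trans hx0, fun j hj => ?_⟩
  · by_contra! hzero
    have h0 := eq_zero_of_iterate_polyExt_eq_zero (N := n) m (v := f a - f b) (p := p) (t := t)
      (n := n) fun j hj => by rw [hv, hzero j hj, Int.cast_zero]
    obtain ⟨h1, h2⟩ := hind α β hαS hβT fun j hj => by
      have := h0 j hj
      rw [hfab] at this
      exact_mod_cast this
    exact hab (Prod.ext (by omega) (by omega))
  · rw [← hv]
    refine (hxb j hj).trans ?_
    gcongr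

/-! ### Large values of integer polynomials -/

lemma abs_pow_le_one_add_pow {a b : ℝ} (h : |a| ≤ b) {j n : ℕ} (hj : j ≤ n) :
    |a ^ j| ≤ (1 + b) ^ n := by
  have hb : 0 ≤ b := (abs_nonneg _).trans h
  rw [abs_pow]
  exact (pow_le_pow_left₀ (abs_nonneg _) (by linarith) j).trans
    (pow_le_pow_right₀ (by linarith) hj)

/-- A nonzero integer polynomial is as large as its height at one of finitely many integers. -/
lemma exists_int_eval_large (n : ℕ) (ξ : ℝ) :
    ∃ τ K : ℝ, 0 ≤ τ ∧ 1 ≤ K ∧ ∀ p : ℕ → ℤ, (∃ j ≤ n, p j ≠ 0) → ∃ t q : ℤ,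
      |(t : ℝ)| ≤ τ ∧ 1 ≤ |ξ - t| ∧ coeffPair n p (fun i => (t : ℝ) ^ i) = q ∧ q ≠ 0 ∧
      (∀ j ≤ n, |(p j : ℝ)| ≤ K * |(q : ℝ)|) ∧
      ∀ H : ℝ, (∀ j ≤ n, |(p j : ℝ)| ≤ H) → |(q : ℝ)| ≤ K * H := by
  -- The nodes `t₀, …, t₀ + n` are distinct, so their Vandermonde matrix is invertible, and all stay
  -- at distance at least `1` from `ξ`.
  set t₀ : ℤ := ⌈|ξ|⌉ + 1 with ht₀
  have ht₀ξ : |ξ| + 1 ≤ (t₀ : ℝ) := by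
    rw [ht₀]; push_cast; linarith [Int.le_ceil |ξ|]
  have hξ0 := abs_nonneg ξ
  set V : Matrix (Fin (n + 1)) (Fin (n + 1)) ℝ :=
    Matrix.vandermonde fun i => (t₀ : ℝ) + (i : ℕ) with hV
  have hdet : IsUnit V.det := by
    rw [isUnit_iff_ne_zero, hV, Matrix.det_vandermonde_ne_zero_iff]
    intro i j hij
    have : ((i : ℕ) : ℝ) = (j : ℕ) := by simpa using hij
    exact Fin.ext (by exact_mod_cast this)
  set L : ℝ := ∑ j, ∑ i, |V⁻¹ j i| with hL
  have hL0 : 0 ≤ L := Finset.sum_nonneg fun _ _ => Finset.sum_nonneg fun _ _ => abs_nonneg _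
  have hτ0 : (0 : ℝ) ≤ t₀ + n := by positivity
  refine ⟨t₀ + n, max 1 (max L ((n + 1) * (1 + (t₀ + n)) ^ n)), hτ0, le_max_left _ _, ?_⟩
  intro p hp
  set P : Fin (n + 1) → ℝ := fun j => p j with hP
  obtain ⟨i₀, hi₀⟩ := Finite.exists_max fun i => |(V.mulVec P) i|
  have hval : ∀ i : Fin (n + 1), (V.mulVec P) i =
      coeffPair n p (fun l => ((t₀ + (i : ℕ) : ℤ) : ℝ) ^ l) := fun i => by
    rw [coeffPair, Finset.sum_range, Matrix.mulVec, dotProduct]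
    refine Finset.sum_congr rfl fun l _ => ?_
    rw [hV, Matrix.vandermonde_apply, hP]
    push_cast
    ring
  have hbound : ∀ j, |P j| ≤ L * |(V.mulVec P) i₀| := fun j => by
    have h1 : P = V⁻¹.mulVec (V.mulVec P) := by
      rw [Matrix.mulVec_mulVec, Matrix.nonsing_inv_mul _ hdet, Matrix.one_mulVec]
    calc |P j| = |∑ i, V⁻¹ j i * (V.mulVec P) i| := by
          conv_lhs => rw [h1]
          rfl
      _ ≤ ∑ i, |V⁻¹ j i| * |(V.mulVec P) i₀| := by
          refine (Finset.abs_sum_le_sum_abs _ _).trans (Finset.sum_le_sum fun i _ => ?_)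
          rw [abs_mul]
          exact mul_le_mul_of_nonneg_left (hi₀ i) (abs_nonneg _)
      _ = (∑ i, |V⁻¹ j i|) * |(V.mulVec P) i₀| := by rw [Finset.sum_mul]
      _ ≤ L * |(V.mulVec P) i₀| := by
          refine mul_le_mul_of_nonneg_right ?_ (abs_nonneg _)
          exact Finset.single_le_sum (f := fun j => ∑ i, |V⁻¹ j i|)
            (fun _ _ => Finset.sum_nonneg fun _ _ => abs_nonneg _) (Finset.mem_univ j)
  set t : ℤ := t₀ + (i₀ : ℕ) with ht
  have hin : ((i₀ : ℕ) : ℝ) ≤ n := by exact_mod_cast Nat.lt_succ_iff.mp i₀.2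
  have htR : (t : ℝ) = t₀ + (i₀ : ℕ) := by rw [ht]; push_cast; ring
  have hi0 : (0 : ℝ) ≤ (i₀ : ℕ) := by positivity
  have htτ : |(t : ℝ)| ≤ t₀ + n := by rw [abs_of_nonneg (by linarith)]; linarith
  obtain ⟨q, hq⟩ := IntegerValued.coeffPair (v := fun i => (t : ℝ) ^ i)
    (fun j => ⟨t ^ j, by simp⟩) n p
  have hq' : (V.mulVec P) i₀ = q := by rw [hval, ← hq]
  have hpq : ∀ j ≤ n, |(p j : ℝ)| ≤ L * |(q : ℝ)| := fun j hj => by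
    rw [← hq']; exact hbound ⟨j, by omega⟩
  refine ⟨t, q, htτ, ?_, hq, ?_, fun j hj => (hpq j hj).trans ?_, fun H hH => ?_⟩
  · rw [abs_sub_comm, le_abs]
    left
    linarith [le_abs_self ξ]
  · rintro rfl
    obtain ⟨j, hj, hpj⟩ := hp
    have := hpq j hj
    simp only [Int.cast_zero, abs_zero, mul_zero] at this
    exact hpj (by exact_mod_cast abs_nonpos_iff.mp this)
  · exact mul_le_mul_of_nonneg_right ((le_max_left _ _).trans (le_max_right _ _)) (abs_nonneg _)
  · have hH0 : 0 ≤ H := (abs_nonneg _).trans (hH 0 (by omega))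
    rw [← hq]
    refine (abs_coeffPair_le hH0 hH fun j hj => abs_pow_le_one_add_pow htτ hj).trans ?_
    calc ((n : ℝ) + 1) * (H * (1 + (t₀ + n)) ^ n) = ((n + 1) * (1 + (t₀ + n)) ^ n) * H := by ring
      _ ≤ _ := mul_le_mul_of_nonneg_right ((le_max_right _ _).trans (le_max_right _ _)) hH0

/-! ### Exponents at points of the Veronese curve -/

/-- The integer `x` becomes coordinate `0`, where the error vanishes; a solution is then a point
close to a geometric progression. -/
lemma simApproxSolvable_veronese_iff {n : ℕ} {ξ lam X : ℝ} :
    SimApproxSolvable (veronese n ξ) lam X ↔ ∃ z : ℕ → ℤ, 1 ≤ |(z 0 : ℝ)| ∧ |(z 0 : ℝ)| ≤ X ∧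
      ∀ j ≤ n, |(z j : ℝ) - z 0 * ξ ^ j| ≤ X ^ (-lam) := by
  constructor
  · rintro ⟨x, y, h1, h2, h3⟩
    refine ⟨fun j => if h : 1 ≤ j ∧ j ≤ n then y ⟨j - 1, by omega⟩ else x, by simpa using h1,
      by simpa using h2, fun j hj => ?_⟩
    rcases Nat.eq_zero_or_pos j with rfl | hj0
    · simpa using Real.rpow_nonneg (by linarith) _
    · have := h3 ⟨j - 1, by omega⟩
      rw [veronese, abs_sub_comm] at this
      simp only [Nat.sub_add_cancel hj0] at this
      simpa [hj, Nat.one_le_iff_ne_zero.mp hj0, Nat.one_le_iff_ne_zero, mul_comm] using this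
  · rintro ⟨z, h1, h2, h3⟩
    refine ⟨z 0, fun j => z (j + 1), h1, h2, fun j => ?_⟩
    rw [veronese, abs_sub_comm, mul_comm]
    exact h3 (j + 1) (by omega)

lemma SimApproxSolvable.mono {N : ℕ} {ξ : Fin N → ℝ} {lam lam' X : ℝ}
    (h : SimApproxSolvable ξ lam X) (hl : lam' ≤ lam) : SimApproxSolvable ξ lam' X := by
  obtain ⟨x, y, h1, h2, h3⟩ := h
  exact ⟨x, y, h1, h2, fun j => (h3 j).trans
    (Real.rpow_le_rpow_of_exponent_le (by linarith) (by linarith))⟩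

lemma SimApproxSolvable.of_le {n k : ℕ} (hnk : n ≤ k) {ξ lam X : ℝ}
    (h : SimApproxSolvable (veronese k ξ) lam X) : SimApproxSolvable (veronese n ξ) lam X := by
  rw [simApproxSolvable_veronese_iff] at h ⊢
  obtain ⟨z, h1, h2, h3⟩ := h
  exact ⟨z, h1, h2, fun j hj => h3 j (hj.trans hnk)⟩

lemma simApproxSolvable_zero {n : ℕ} {ξ X : ℝ} (hX : 1 ≤ X) :
    SimApproxSolvable (veronese n ξ) 0 X := by
  refine ⟨1, fun j => ⌊veronese n ξ j⌋, by simp, by simpa, fun j => ?_⟩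
  simp only [Int.cast_one, mul_one, neg_zero, Real.rpow_zero]
  rw [Int.self_sub_floor, Int.abs_fract]
  exact (Int.fract_lt_one _).le

lemma coe_le_lambdaExp {n : ℕ} {ξ lam : ℝ}
    (h : ∃ᶠ X : ℝ in atTop, SimApproxSolvable (veronese n ξ) lam X) :
    (lam : EReal) ≤ lambdaExp n ξ :=
  le_iSup₂ (f := fun (lam : ℝ)
    (_ : lam ∈ {lam : ℝ | ∃ᶠ X : ℝ in atTop, SimApproxSolvable (veronese n ξ) lam X}) =>
      (lam : EReal)) lam h

lemma coe_le_lambdaHatExp {n : ℕ} {ξ lam : ℝ}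
    (h : ∀ᶠ X : ℝ in atTop, SimApproxSolvable (veronese n ξ) lam X) :
    (lam : EReal) ≤ lambdaHatExp n ξ :=
  le_iSup₂ (f := fun (lam : ℝ)
    (_ : lam ∈ {lam : ℝ | ∀ᶠ X : ℝ in atTop, SimApproxSolvable (veronese n ξ) lam X}) =>
      (lam : EReal)) lam h

lemma frequently_of_coe_lt_lambdaExp {n : ℕ} {ξ lam : ℝ} (h : (lam : EReal) < lambdaExp n ξ) :
    ∃ᶠ X : ℝ in atTop, SimApproxSolvable (veronese n ξ) lam X := by
  obtain ⟨l, hl, hlt⟩ : ∃ l, ∃ _ : l ∈ {lam : ℝ | ∃ᶠ X : ℝ in atTop,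
      SimApproxSolvable (veronese n ξ) lam X}, (lam : EReal) < (l : EReal) := by
    simpa only [lambdaExp, simExponent, lt_iSup_iff] using h
  exact hl.mono fun X hX => hX.mono (EReal.coe_lt_coe_iff.mp hlt).le

lemma eventually_of_coe_lt_lambdaHatExp {n : ℕ} {ξ lam : ℝ}
    (h : (lam : EReal) < lambdaHatExp n ξ) :
    ∀ᶠ X : ℝ in atTop, SimApproxSolvable (veronese n ξ) lam X := by
  obtain ⟨l, hl, hlt⟩ : ∃ l, ∃ _ : l ∈ {lam : ℝ | ∀ᶠ X : ℝ in atTop,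
      SimApproxSolvable (veronese n ξ) lam X}, (lam : EReal) < (l : EReal) := by
    simpa only [lambdaHatExp, uniformSimExponent, lt_iSup_iff] using h
  exact hl.mono fun X hX => hX.mono (EReal.coe_lt_coe_iff.mp hlt).le

lemma lambdaHatExp_nonneg (n : ℕ) (ξ : ℝ) : 0 ≤ lambdaHatExp n ξ :=
  coe_le_lambdaHatExp (lam := 0)
    ((eventually_ge_atTop 1).mono fun _ hX => simApproxSolvable_zero hX)

lemma lambdaHatExp_le_lambdaExp (n : ℕ) (ξ : ℝ) : lambdaHatExp n ξ ≤ lambdaExp n ξ :=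
  iSup₂_le fun _ h => coe_le_lambdaExp (Eventually.frequently h)

lemma lambdaExp_anti {n k : ℕ} (hnk : n ≤ k) (ξ : ℝ) : lambdaExp k ξ ≤ lambdaExp n ξ :=
  iSup₂_le fun _ h => coe_le_lambdaExp (Frequently.mono h fun _ hX => hX.of_le hnk)

lemma lambdaHatExp_le_of_forall {n : ℕ} {ξ c : ℝ}
    (h : ∀ lam, (∀ᶠ X : ℝ in atTop, SimApproxSolvable (veronese n ξ) lam X) → lam ≤ c) :
    lambdaHatExp n ξ ≤ c :=
  iSup₂_le fun lam hl => EReal.coe_le_coe_iff.mpr (h lam hl)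

/-- A criterion for a lower bound of `lambdaExp`, by points close to the line through
`(1, ξ, …, ξ ^ k)`. -/
lemma div_le_lambdaExp {k : ℕ} {ξ a b C : ℝ} (ha : 0 < a) (hC : 1 ≤ C)
    (h : ∀ B : ℝ, ∃ Y ≥ B, ∃ (v : ℕ → ℤ) (x : ℝ), (∃ j ≤ k, v j ≠ 0) ∧ |x| ≤ C * Y ^ a ∧
      ∀ j ≤ k, |(v j : ℝ) - x * ξ ^ j| ≤ C * Y ^ (-b)) :
    ((b / a : ℝ) : EReal) ≤ lambdaExp k ξ := by
  rcases le_or_gt b 0 with hb | hb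
  · refine le_trans ?_ ((lambdaHatExp_nonneg k ξ).trans (lambdaHatExp_le_lambdaExp k ξ))
    exact_mod_cast div_nonpos_of_nonpos_of_nonneg hb ha.le
  by_contra! hlt
  obtain ⟨lam, hl1, hl2⟩ := EReal.lt_iff_exists_real_btwn.mp hlt
  refine absurd (coe_le_lambdaExp ?_) hl1.not_ge
  have hlam : 0 < b - a * lam := by
    have := (lt_div_iff₀ ha).mp (EReal.coe_lt_coe_iff.mp hl2)
    linarith
  rw [frequently_atTop]
  intro B
  set M : ℝ := (1 + |ξ|) ^ k with hM
  have hM1 : 1 ≤ M := one_le_pow₀ (by linarith [abs_nonneg ξ])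
  -- For large `Y` these put the new `X` beyond `B`, make the error less than `1`, and absorb the
  -- constants, as `lam < b / a`.
  have e1 := (tendsto_rpow_atTop ha).eventually_ge_atTop B
  have e2 := (tendsto_rpow_atTop hb).eventually_gt_atTop ((M + 1) * C)
  have e3 := (tendsto_rpow_atTop hlam).eventually_ge_atTop ((M + 1) * C * (2 * C) ^ lam)
  obtain ⟨B₀, hB₀⟩ := eventually_atTop.mp (((e1.and e2).and e3).and (eventually_ge_atTop 1))
  obtain ⟨Y, hY, v, x, hv, hx, hvx⟩ := h B₀
  obtain ⟨⟨⟨h1, h2⟩, h3⟩, hY1⟩ := hB₀ Y hY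
  have hY0 : 0 < Y := by linarith
  have hYa : 1 ≤ Y ^ a := Real.one_le_rpow hY1 ha.le
  have hYb : Y ^ (-b) ≤ 1 := Real.rpow_le_one_of_one_le_of_nonpos hY1 (by linarith)
  have hYb0 : 0 < Y ^ (-b) := Real.rpow_pos_of_pos hY0 _
  have hsmall : (M + 1) * C * Y ^ (-b) < 1 := by
    rw [Real.rpow_neg hY0.le, ← div_eq_mul_inv, div_lt_one (Real.rpow_pos_of_pos hY0 _)]
    exact h2
  have hξM : ∀ j ≤ k, |ξ ^ j| ≤ M := fun j hj => abs_pow_le_one_add_pow le_rfl hj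
  have hv0 : |(v 0 : ℝ) - x| ≤ C * Y ^ (-b) := by simpa using hvx 0 (by omega)
  have herr : ∀ j ≤ k, |(v j : ℝ) - v 0 * ξ ^ j| ≤ (M + 1) * C * Y ^ (-b) := fun j hj => by
    calc |(v j : ℝ) - v 0 * ξ ^ j| = |((v j : ℝ) - x * ξ ^ j) - ((v 0 : ℝ) - x) * ξ ^ j| := by
          congr 1; ring
      _ ≤ |(v j : ℝ) - x * ξ ^ j| + |(v 0 : ℝ) - x| * |ξ ^ j| := by
          rw [← abs_mul]; exact abs_sub _ _
      _ ≤ C * Y ^ (-b) + C * Y ^ (-b) * M := by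
          have := hvx j hj
          have := hξM j hj
          gcongr
      _ = _ := by ring
  refine ⟨2 * C * Y ^ a, by nlinarith, simApproxSolvable_veronese_iff.mpr ⟨v, ?_, ?_, ?_⟩⟩
  -- If `v 0` were zero, every coordinate would be an integer of absolute value below `1`, so `v`
  -- would vanish up to index `k`.
  · have : v 0 ≠ 0 := fun h0 => by
      obtain ⟨j, hj, hvj⟩ := hv
      have := herr j hj
      rw [h0, Int.cast_zero, zero_mul, sub_zero] at this
      have h4 : (1 : ℝ) ≤ |(v j : ℝ)| := by exact_mod_cast Int.one_le_abs hvj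
      linarith
    exact_mod_cast Int.one_le_abs this
  · have : |(v 0 : ℝ)| ≤ |(v 0 : ℝ) - x| + |x| := by
      simpa using abs_add_le ((v 0 : ℝ) - x) x
    nlinarith
  · intro j hj
    refine (herr j hj).trans ?_
    have hC2 : 0 < 2 * C := by linarith
    rw [Real.mul_rpow hC2.le (Real.rpow_nonneg hY0.le _), ← Real.rpow_mul hY0.le,
      Real.rpow_neg hC2.le, inv_mul_eq_div, le_div_iff₀ (Real.rpow_pos_of_pos hC2 _)]
    have : Y ^ (a * -lam) = Y ^ (b - a * lam) * Y ^ (-b) := by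
      rw [← Real.rpow_add hY0]; congr 1; ring
    rw [this]
    calc (M + 1) * C * Y ^ (-b) * (2 * C) ^ lam = (M + 1) * C * (2 * C) ^ lam * Y ^ (-b) := by ring
      _ ≤ _ := mul_le_mul_of_nonneg_right h3 hYb0.le

/-! ### The bound from linear polynomials -/

lemma coeffPair_linear {n : ℕ} (hn : 1 ≤ n) (a b : ℤ) (w : ℕ → ℝ) :
    coeffPair n (fun j => if j = 0 then a else if j = 1 then b else 0) w = a * w 0 + b * w 1 := by
  obtain ⟨m, rfl⟩ := Nat.exists_eq_add_of_le' hn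
  rw [coeffPair, Finset.sum_range_succ', Finset.sum_range_succ']
  simp [add_comm]

/-- The lower bound for `lambdaExp` obtained from extensions by linear polynomials. -/
lemma sub_div_le_lambdaExp {n m : ℕ} (hn : 1 ≤ n) {ξ lam : ℝ} (hlam : 0 < lam)
    (h : ∃ᶠ X : ℝ in atTop, SimApproxSolvable (veronese n ξ) lam X) :
    (((lam - m) / (1 + m) : ℝ) : EReal) ≤ lambdaExp (n + m) ξ := by
  obtain ⟨τ, K, hτ, hK, heval⟩ := exists_int_eval_large n ξ
  obtain ⟨C, hC, hext⟩ := exists_int_extension n m τ K hτ (by linarith)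
  set C₁ : ℝ := K * (|ξ| + 1) with hC₁
  have hC₁1 : 1 ≤ C₁ := one_le_mul_of_one_le_of_one_le hK (by linarith [abs_nonneg ξ])
  have hC₁m : 1 ≤ C₁ ^ m := one_le_pow₀ hC₁1
  refine div_le_lambdaExp (C := C * C₁ ^ m * (1 + K)) (by positivity)
    (one_le_mul_of_one_le_of_one_le (one_le_mul_of_one_le_of_one_le hC hC₁m) (by linarith)) ?_
  intro B
  obtain ⟨X, hX, hsol⟩ := frequently_atTop.mp h B
  obtain ⟨z, hz1, hz2, hz3⟩ := simApproxSolvable_veronese_iff.mp hsol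
  have hX1 : 1 ≤ X := hz1.trans hz2
  have hX0 : 0 < X := by linarith
  have hz0 : z 0 ≠ 0 := fun h0 => by norm_num [h0] at hz1
  have hE1 : X ^ (-lam) ≤ 1 := Real.rpow_le_one_of_one_le_of_nonpos hX1 (by linarith)
  have hE0 : 0 < X ^ (-lam) := Real.rpow_pos_of_pos hX0 _
  -- The linear polynomial with root `z 1 / z 0`: its value at `ξ` is the error of `z` at index `1`.
  set p : ℕ → ℤ := fun j => if j = 0 then z 1 else if j = 1 then -z 0 else 0 with hp
  have hz1ξ : |(z 1 : ℝ) - z 0 * ξ| ≤ X ^ (-lam) := by simpa using hz3 1 hn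
  obtain ⟨t, q, htτ, hξt, hq, hq0, hpq, hH⟩ := heval p ⟨1, hn, by simpa [hp] using hz0⟩
  have hqR : 0 < |(q : ℝ)| := abs_pos.mpr (by exact_mod_cast hq0)
  have hqX : |(q : ℝ)| ≤ C₁ * X := by
    rw [hC₁, mul_assoc]
    refine hH _ fun j _ => ?_
    have hmul : 0 ≤ |ξ| * X := by positivity
    by_cases hj0 : j = 0
    · simp only [hp, hj0, if_true]
      have : |(z 1 : ℝ)| ≤ |(z 1 : ℝ) - z 0 * ξ| + |(z 0 : ℝ)| * |ξ| := by
        rw [← abs_mul]; simpa using abs_add_le ((z 1 : ℝ) - z 0 * ξ) (z 0 * ξ)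
      have h2 : |(z 0 : ℝ)| * |ξ| ≤ X * |ξ| := by gcongr
      linarith
    · by_cases hj1 : j = 1
      · simp only [hp, hj1, one_ne_zero, if_true, if_false, Int.cast_neg, abs_neg]
        linarith
      · simp only [hp, hj0, hj1, if_false, Int.cast_zero, abs_zero]
        positivity
  have hzq : |(z 0 : ℝ)| ≤ K * |(q : ℝ)| := by simpa [hp] using hpq 1 hn
  set δ : ℝ := X ^ (-lam) / |(q : ℝ)| with hδ
  have hδz : δ * |(z 0 : ℝ)| ≤ K * X ^ (-lam) := by
    rw [hδ, div_mul_eq_mul_div, div_le_iff₀ hqR]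
    nlinarith
  -- Multiples of `z` suffice: `T = 0` makes the second vector a dummy, and `0, …, |q| ^ m` are one
  -- more than `|q| ^ m` multipliers.
  obtain ⟨v, x, hv, hx, hvx⟩ := hext ξ δ (X ^ (-lam)) (X ^ (-lam)) p t q z z (q.natAbs ^ m) 0
    htτ hξt hpq hq hq0
    (by
      rw [hp, coeffPair_linear hn, hδ, div_mul_cancel₀ _ hqR.ne']
      push_cast
      rw [pow_zero, mul_one, pow_one, neg_mul, ← sub_eq_add_neg]
      exact hz1ξ)
    hz3 hz3
    (fun α β _ hβ hαβ => by
      have hβ0 : β = 0 := by simpa using hβ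
      have := hαβ 0 (by omega)
      simp only [hβ0, zero_mul, add_zero, mul_eq_zero, hz0, or_false] at this
      exact ⟨this, hβ0⟩)
    (by simp)
  have hS : ((q.natAbs ^ m : ℕ) : ℝ) ≤ C₁ ^ m * X ^ (m : ℝ) := by
    rw [Real.rpow_natCast, ← mul_pow, Nat.cast_pow, Nat.cast_natAbs, Int.cast_abs]
    gcongr
  have hXm : 0 < X ^ (m : ℝ) := Real.rpow_pos_of_pos hX0 _
  have hCC : 0 < C * C₁ ^ m * (1 + K) := by positivity
  refine ⟨X, hX, v, x, hv, hx.trans ?_, fun j hj => (hvx j hj).trans ?_⟩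
  · rw [Real.rpow_add hX0, Real.rpow_one]
    calc ((q.natAbs ^ m : ℕ) : ℝ) * |(z 0 : ℝ)| + (0 : ℕ) * |(z 0 : ℝ)|
        ≤ (C₁ ^ m * X ^ (m : ℝ)) * X := by
          rw [Nat.cast_zero, zero_mul, add_zero]
          gcongr
      _ = 1 * C₁ ^ m * 1 * (X * X ^ (m : ℝ)) := by ring
      _ ≤ C * C₁ ^ m * (1 + K) * (X * X ^ (m : ℝ)) := by
          gcongr
          linarith
  · have hXb : X ^ (-(lam - m)) = X ^ (m : ℝ) * X ^ (-lam) := by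
      rw [← Real.rpow_add hX0]; congr 1; ring
    rw [hXb]
    calc C * (((q.natAbs ^ m : ℕ) : ℝ) * X ^ (-lam) + (0 : ℕ) * X ^ (-lam) +
          δ * (((q.natAbs ^ m : ℕ) : ℝ) * |(z 0 : ℝ)| + (0 : ℕ) * |(z 0 : ℝ)|))
        = C * (((q.natAbs ^ m : ℕ) : ℝ) * (X ^ (-lam) + δ * |(z 0 : ℝ)|)) := by
          rw [Nat.cast_zero]; ring
      _ ≤ C * ((C₁ ^ m * X ^ (m : ℝ)) * (X ^ (-lam) + K * X ^ (-lam))) := by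
          gcongr
      _ = _ := by ring

/-! ### Independent approximations and the range of the uniform exponent -/

/-- Arbitrarily large good approximations, together with an independent smaller approximation. -/
lemma exists_independent_pair {n : ℕ} (hn : 1 ≤ n) {ξ lam mu : ℝ} (hξ : Irrational ξ)
    (hlam : 0 < lam) (h : ∃ᶠ X : ℝ in atTop, SimApproxSolvable (veronese n ξ) lam X)
    (hmu : ∀ᶠ X : ℝ in atTop, SimApproxSolvable (veronese n ξ) mu X) (B : ℝ) :
    ∃ z z' : ℕ → ℤ, B ≤ |(z 0 : ℝ)| ∧ 1 ≤ |(z 0 : ℝ)| ∧ |(z' 0 : ℝ)| ≤ |(z 0 : ℝ)| ∧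
      (∀ j ≤ n, |(z j : ℝ) - z 0 * ξ ^ j| ≤ |(z 0 : ℝ)| ^ (-lam)) ∧
      (∀ j ≤ n, |(z' j : ℝ) - z' 0 * ξ ^ j| ≤ 2 ^ mu * |(z 0 : ℝ)| ^ (-mu)) ∧
      ∃ j ≤ n, z' 0 * z j ≠ z 0 * z' j := by
  obtain ⟨B₁, hB₁⟩ := eventually_atTop.mp hmu
  set A : ℤ := ⌈max B (2 * B₁)⌉ with hA
  -- By irrationality, denominators up to `A` have errors bounded away from zero, so the one found
  -- for large `X` exceeds `A`.
  have hfar : ∀ᶠ X : ℝ in atTop, ∀ a ∈ (Finset.Icc (-A) A).filter (· ≠ 0),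
      X ^ (-lam) < |ξ * (a : ℝ) - round (ξ * (a : ℝ))| := by
    rw [Filter.eventually_all_finset]
    intro a ha
    refine (tendsto_rpow_neg_atTop hlam).eventually_lt_const (abs_pos.mpr ?_)
    rw [sub_ne_zero]
    exact (hξ.mul_intCast (Finset.mem_filter.mp ha).2).ne_int _
  obtain ⟨X, hX, hXfar⟩ := (h.and_eventually hfar).exists
  classical
  obtain ⟨z₀, hz₀1, hz₀2, hz₀3⟩ := simApproxSolvable_veronese_iff.mp hX
  -- Among points with error at most `X ^ (-lam)`, `z` is taken with `|z 0|` minimal.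
  have hex : ∃ N : ℕ, ∃ z : ℕ → ℤ, (z 0).natAbs = N ∧ z 0 ≠ 0 ∧
      ∀ j ≤ n, |(z j : ℝ) - z 0 * ξ ^ j| ≤ X ^ (-lam) :=
    ⟨_, z₀, rfl, fun h0 => by norm_num [h0] at hz₀1, hz₀3⟩
  obtain ⟨z, hzN, hz0, hz⟩ := Nat.find_spec hex
  have hmin := fun N => Nat.find_min (H := hex) (m := N)
  have hle : Nat.find hex ≤ (z₀ 0).natAbs :=
    Nat.find_le ⟨z₀, rfl, fun h0 => by norm_num [h0] at hz₀1, hz₀3⟩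
  rw [← hzN] at hmin hle
  have hzX : |(z 0 : ℝ)| ≤ X := by
    refine le_trans ?_ hz₀2
    rw [← Int.cast_abs, ← Int.cast_abs, Int.cast_le, Int.abs_eq_natAbs, Int.abs_eq_natAbs]
    omega
  have hz1 : 1 ≤ |(z 0 : ℝ)| := by exact_mod_cast Int.one_le_abs hz0
  have hzA : (A : ℝ) < |(z 0 : ℝ)| := by
    by_contra! hle'
    have hle'' : |z 0| ≤ A := by exact_mod_cast hle'
    have h1 := hXfar (z 0) (Finset.mem_filter.mpr ⟨Finset.mem_Icc.mpr (abs_le.mp hle''), hz0⟩)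
    have h2 := round_le (ξ * (z 0 : ℝ)) (z 1)
    have h3 := hz 1 hn
    rw [pow_one, abs_sub_comm, mul_comm] at h3
    linarith
  have hBA : max B (2 * B₁) ≤ A := Int.le_ceil _
  have hBz : B ≤ |(z 0 : ℝ)| := (le_max_left _ _).trans (hBA.trans hzA.le)
  have hB₁z : B₁ ≤ |(z 0 : ℝ)| / 2 := by linarith [le_max_right B (2 * B₁)]
  -- Solving at `|z 0| / 2` makes `|z' 0|` strictly smaller than `|z 0|`; this is the source of the
  -- factor `2 ^ mu`.
  obtain ⟨z', hz'1, hz'2, hz'3⟩ := simApproxSolvable_veronese_iff.mp (hB₁ _ hB₁z)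
  have hlt : |(z' 0 : ℝ)| < |(z 0 : ℝ)| := by linarith
  refine ⟨z, z', hBz, hz1, hlt.le, fun j hj => (hz j hj).trans ?_, fun j hj =>
    (hz'3 j hj).trans_eq ?_, ?_⟩
  · exact Real.rpow_le_rpow_of_nonpos (by linarith) hzX (by linarith)
  · rw [Real.div_rpow (by linarith) (by norm_num), Real.rpow_neg (by norm_num : (0 : ℝ) ≤ 2),
      div_inv_eq_mul, mul_comm]
  -- A proportional `z'` would have the error of `z` scaled by `|z' 0| / |z 0| < 1`, against
  -- minimality.
  · by_contra! hdep
    refine hmin (z' 0).natAbs ?_ ⟨z', rfl, fun h0 => by norm_num [h0] at hz'1, fun j hj => ?_⟩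
    · have : |z' 0| < |z 0| := by exact_mod_cast hlt
      rw [Int.abs_eq_natAbs, Int.abs_eq_natAbs] at this
      omega
    · have hd : (z' 0 : ℝ) * z j = z 0 * z' j := by exact_mod_cast hdep j hj
      have hpos : 0 < |(z 0 : ℝ)| := by linarith
      have : |(z 0 : ℝ)| * |(z' j : ℝ) - z' 0 * ξ ^ j| =
          |(z' 0 : ℝ)| * |(z j : ℝ) - z 0 * ξ ^ j| := by
        rw [← abs_mul, ← abs_mul]
        congr 1
        linear_combination -hd
      refine le_trans ?_ (hz j hj)
      refine le_of_mul_le_mul_left ?_ hpos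
      rw [this]
      gcongr

lemma abs_wronskian_le {n : ℕ} {ξ E E' : ℝ} {z z' : ℕ → ℤ} (hzz' : |(z' 0 : ℝ)| ≤ |(z 0 : ℝ)|)
    (hz : ∀ j ≤ n, |(z j : ℝ) - z 0 * ξ ^ j| ≤ E)
    (hz' : ∀ j ≤ n, |(z' j : ℝ) - z' 0 * ξ ^ j| ≤ E') {j : ℕ} (hj : j ≤ n) :
    |((z' 0 * z j - z 0 * z' j : ℤ) : ℝ)| ≤ |(z 0 : ℝ)| * (E + E') := by
  have : ((z' 0 * z j - z 0 * z' j : ℤ) : ℝ) =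
      z' 0 * (z j - z 0 * ξ ^ j) - z 0 * (z' j - z' 0 * ξ ^ j) := by push_cast; ring
  rw [this, mul_add]
  refine (abs_sub _ _).trans ?_
  rw [abs_mul, abs_mul]
  have := hz j hj
  have := hz' j hj
  gcongr

/-- Independence makes some minor a nonzero integer, while its size is `O(Y ^ (1 - mu))`; for `mu >
1` this tends to zero. -/
lemma le_one_of_eventually_simApproxSolvable {n : ℕ} (hn : 1 ≤ n) {ξ mu : ℝ} (hξ : Irrational ξ)
    (hmu : ∀ᶠ X : ℝ in atTop, SimApproxSolvable (veronese n ξ) mu X) : mu ≤ 1 := by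
  by_contra! h1
  have hlim := (tendsto_rpow_atTop (y := mu - 1) (by linarith)).eventually_gt_atTop (1 + 2 ^ mu)
  obtain ⟨B, hB⟩ := eventually_atTop.mp hlim
  obtain ⟨z, z', hBz, hz1, hzz', hz, hz', j, hj, hne⟩ :=
    exists_independent_pair hn hξ (by linarith) hmu.frequently hmu B
  have h2 := abs_wronskian_le hzz' hz hz' hj
  have h3 : (1 : ℝ) ≤ |((z' 0 * z j - z 0 * z' j : ℤ) : ℝ)| := by
    exact_mod_cast Int.one_le_abs (sub_ne_zero.mpr hne)
  have h4 := hB _ hBz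
  set Y := |(z 0 : ℝ)| with hY
  have hY0 : 0 < Y := by linarith
  have h5 : Y * (Y ^ (-mu) + 2 ^ mu * Y ^ (-mu)) * Y ^ (mu - 1) = 1 + 2 ^ mu := by
    have : Y * Y ^ (-mu) * Y ^ (mu - 1) = 1 := by
      nth_rewrite 1 [← Real.rpow_one Y]
      rw [← Real.rpow_add hY0, ← Real.rpow_add hY0]
      ring_nf
      exact Real.rpow_zero _
    linear_combination (1 + 2 ^ mu) * this
  have h6 : 0 < Y ^ (mu - 1) := Real.rpow_pos_of_pos hY0 _
  nlinarith

lemma lambdaHatExp_le_one {n : ℕ} (hn : 1 ≤ n) {ξ : ℝ} (hξ : Irrational ξ) :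
    lambdaHatExp n ξ ≤ ((1 : ℝ) : EReal) :=
  lambdaHatExp_le_of_forall fun _ h => le_one_of_eventually_simApproxSolvable hn hξ h

lemma one_le_lambdaHatExp_one (ξ : ℝ) : ((1 : ℝ) : EReal) ≤ lambdaHatExp 1 ξ := by
  refine coe_le_lambdaHatExp ((eventually_ge_atTop 1).mono fun X hX => ?_)
  have hfl : 0 < ⌊X⌋₊ := Nat.floor_pos.mpr hX
  obtain ⟨a, b, hb0, hb, hab⟩ := Real.exists_int_int_abs_mul_sub_le ξ hfl
  refine ⟨b, fun _ => a, ?_, ?_, fun j => ?_⟩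
  · exact_mod_cast Int.one_le_abs hb0.ne'
  · rw [abs_of_pos (by exact_mod_cast hb0)]
    have : (b : ℝ) ≤ (⌊X⌋₊ : ℝ) := by exact_mod_cast hb
    exact this.trans (Nat.floor_le (by linarith))
  · rw [Real.rpow_neg_one, ← one_div, mul_comm]
    have hj : veronese 1 ξ j = ξ := by simp [veronese]
    rw [hj]
    refine hab.trans ?_
    gcongr
    exact (Nat.lt_floor_add_one X).le

/-- Clearing denominators by `r.den ^ n` gives a fixed point with zero error. -/
lemma lambdaExp_eq_top_of_not_irrational {n : ℕ} {ξ : ℝ} (hξ : ¬ Irrational ξ) :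
    lambdaExp n ξ = ⊤ := by
  rw [Irrational, not_not] at hξ
  obtain ⟨r, rfl⟩ := hξ
  refine EReal.eq_top_iff_forall_lt _ |>.mpr fun lam => lt_of_lt_of_le
    (EReal.coe_lt_coe_iff.mpr (lt_add_one lam)) (coe_le_lambdaExp (Eventually.frequently ?_))
  have hden : (r.den : ℝ) ≠ 0 := by exact_mod_cast r.den_ne_zero
  filter_upwards [eventually_ge_atTop ((r.den : ℝ) ^ n), eventually_ge_atTop 1] with X hX hX1
  refine simApproxSolvable_veronese_iff.mpr ⟨fun j => r.num ^ j * r.den ^ (n - j), ?_, ?_, ?_⟩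
  · have : (1 : ℝ) ≤ (r.den : ℝ) ^ n := one_le_pow₀ (by exact_mod_cast r.den_pos)
    simpa using this
  · simpa using hX
  · intro j hj
    have : (((r.num ^ j * r.den ^ (n - j) : ℤ) : ℝ)) -
        ((r.num ^ 0 * r.den ^ (n - 0) : ℤ) : ℝ) * (r : ℝ) ^ j = 0 := by
      push_cast
      rw [Rat.cast_def, div_pow, pow_zero, one_mul, Nat.sub_zero, ← Nat.sub_add_cancel hj, pow_add,
        Nat.sub_add_cancel hj]
      field_simp
      simp
    rw [this, abs_zero]
    exact Real.rpow_nonneg (by linarith) _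

/-! ### A small polynomial annihilating an approximation -/

/-- A small nonzero integer vector annihilating `z`, found with the help of a second vector. -/
lemma exists_small_annihilator {n : ℕ} (hn : 2 ≤ n) (ξ : ℝ) :
    ∃ C : ℝ, 1 ≤ C ∧ ∀ (z z' : ℕ → ℤ) (E E' : ℝ), 1 ≤ |(z 0 : ℝ)| →
      |(z' 0 : ℝ)| ≤ |(z 0 : ℝ)| → E ≤ 1 → E ≤ E' →
      (∀ j ≤ n, |(z j : ℝ) - z 0 * ξ ^ j| ≤ E) →
      (∀ j ≤ n, |(z' j : ℝ) - z' 0 * ξ ^ j| ≤ E') →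
      (∃ j ≤ n, z' 0 * z j ≠ z 0 * z' j) →
      ∃ p : ℕ → ℤ, (∃ j ≤ n, p j ≠ 0) ∧ ∑ j ∈ Finset.range (n + 1), p j * z j = 0 ∧
        ∀ j ≤ n, |(p j : ℝ)| ≤ C * (|(z 0 : ℝ)| * E') ^ (1 / ((n : ℝ) - 1)) := by
  have hnR : (2 : ℝ) ≤ n := by exact_mod_cast hn
  set s : ℝ := 1 / ((n : ℝ) - 1) with hs
  have hs0 : 0 < s := by rw [hs]; apply one_div_pos.mpr; linarith
  set M : ℝ := (1 + |ξ|) ^ n + 1 with hM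
  have hM1 : 1 ≤ M := by
    have : 0 ≤ (1 + |ξ|) ^ n := by positivity
    linarith
  -- The constant is `4 * 2 * 5` times `(n + 1) ^ 2 * M`, collected from the two counts `2 * A + 1`
  -- and `2 * B + 1` below.
  set D : ℝ := 40 * ((n : ℝ) + 1) ^ 2 * M with hD
  have hD2 : 2 ≤ D := by
    have h1 : (1 : ℝ) ≤ ((n : ℝ) + 1) ^ 2 := one_le_pow₀ (by linarith)
    have h2 : 1 ≤ ((n : ℝ) + 1) ^ 2 * M := one_le_mul_of_one_le_of_one_le h1 hM1
    rw [hD, mul_assoc]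
    linarith
  have hDs : 1 ≤ D ^ s := Real.one_le_rpow (by linarith) hs0.le
  refine ⟨2 * D ^ s, by linarith, ?_⟩
  intro z z' E E' hz1 hzz' hE hEE' hz hz' ⟨j₀, hj₀, hne⟩
  have hz0 : z 0 ≠ 0 := fun h0 => by norm_num [h0] at hz1
  set g : ℕ := Int.gcd (z 0) (z' 0) with hg
  have hgpos : 0 < g := Int.gcd_pos_of_ne_zero_left _ hz0
  obtain ⟨u, u', hcop, hu, hu'⟩ := Int.exists_gcd_one hgpos
  rw [← hg] at hu hu'
  have hu0 : u ≠ 0 := fun h0 => hz0 (by rw [hu, h0, zero_mul])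
  set Y : ℝ := |(z 0 : ℝ)| * E' with hY
  have hgR : (0 : ℝ) < g := by exact_mod_cast hgpos
  have hg1 : (1 : ℝ) ≤ g := by exact_mod_cast hgpos
  -- Minors divided by the gcd `g`. Vanishing on `w` forces `u` to divide the pairing with `z`,
  -- because `u` and `u'` are coprime.
  set w : ℕ → ℤ := fun j => u' * z j - u * z' j with hw
  have hgw : ∀ j, z' 0 * z j - z 0 * z' j = g * w j := fun j => by
    simp only [hw]
    rw [hu, hu']
    ring
  have hwb : ∀ j ≤ n, g * |(w j : ℝ)| ≤ 2 * Y := fun j hj => by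
    have h1 := abs_wronskian_le hzz' hz hz' hj
    rw [hgw] at h1
    push_cast at h1
    rw [abs_mul, abs_of_pos hgR] at h1
    have h2 : |(z 0 : ℝ)| * (E + E') ≤ |(z 0 : ℝ)| * (E' + E') := by gcongr
    linarith
  have hgY : g ≤ 2 * Y := by
    have h1 : w j₀ ≠ 0 := fun h0 => hne (sub_eq_zero.mp (by rw [hgw, h0, mul_zero]))
    have h2 : (1 : ℝ) ≤ |(w j₀ : ℝ)| := by exact_mod_cast Int.one_le_abs h1
    nlinarith [hwb j₀ hj₀]
  have hzb : ∀ j ≤ n, |(z j : ℝ)| ≤ M * |(z 0 : ℝ)| := fun j hj => by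
    have h1 : |(z j : ℝ)| ≤ |(z j : ℝ) - z 0 * ξ ^ j| + |(z 0 : ℝ)| * |ξ ^ j| := by
      rw [← abs_mul]; simpa using abs_add_le ((z j : ℝ) - z 0 * ξ ^ j) (z 0 * ξ ^ j)
    have h2 : |ξ ^ j| ≤ (1 + |ξ|) ^ n := abs_pow_le_one_add_pow le_rfl hj
    have h3 : |(z 0 : ℝ)| * |ξ ^ j| ≤ |(z 0 : ℝ)| * (1 + |ξ|) ^ n := by gcongr
    have h4 := hz j hj
    rw [hM]
    linarith
  have hDY : 1 ≤ D * Y := by nlinarith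
  have hY0 : 0 ≤ Y := by linarith
  have hDYs : 1 ≤ (D * Y) ^ s := Real.one_le_rpow hDY hs0.le
  set H : ℕ := ⌈(D * Y) ^ s⌉₊ with hH
  have hHge : (D * Y) ^ s ≤ H := Nat.le_ceil _
  have hHle : (H : ℝ) ≤ 2 * D ^ s * Y ^ s := by
    have := Nat.ceil_lt_add_one (by linarith : 0 ≤ (D * Y) ^ s)
    rw [mul_assoc, ← Real.mul_rpow (by linarith) hY0]
    linarith
  have hH1 : (1 : ℝ) ≤ H := hDYs.trans hHge
  set F : (Fin (n + 1) → ℕ) → (ℕ → ℤ) → ℤ := fun a y => ∑ i, (a i : ℤ) * y i with hF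
  have hFb : ∀ a ∈ Fintype.piFinset (fun _ : Fin (n + 1) => Finset.range (H + 1)),
      ∀ (y : ℕ → ℤ) (R : ℝ), (∀ j ≤ n, |(y j : ℝ)| ≤ R) →
        |(F a y : ℝ)| ≤ (n + 1) * (H * R) := fun a ha y R hy => by
    rw [hF]
    push_cast
    refine (Finset.abs_sum_le_sum_abs _ _).trans ?_
    have : ∀ i ∈ (Finset.univ : Finset (Fin (n + 1))), |(a i : ℝ) * (y i : ℝ)| ≤ H * R :=
      fun i _ => by
        have h1 : a i ≤ H := by
          have := Fintype.mem_piFinset.mp ha i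
          rw [Finset.mem_range] at this
          omega
        rw [abs_mul, Nat.abs_cast]
        have := hy i (by omega)
        gcongr
    simpa using Finset.sum_le_card_nsmul _ _ _ this
  set A : ℕ := ⌊((n : ℝ) + 1) * (H * (2 * Y / g))⌋₊ with hA
  -- It is enough to locate the pairing with `z` up to `|u|`, so only its quotient by `u` is
  -- recorded; the `+ 1` pays for the remainder. The factor `g` here cancels the `1 / g` in `A`.
  set B : ℕ := ⌊((n : ℝ) + 1) * (H * (M * g)) + 1⌋₊ with hB
  have hmapsA : ∀ a ∈ Fintype.piFinset (fun _ : Fin (n + 1) => Finset.range (H + 1)),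
      F a w ∈ Finset.Icc (-(A : ℤ)) A := fun a ha => by
    have h1 := hFb a ha w (2 * Y / g) fun j hj => by
      rw [le_div_iff₀ hgR, mul_comm]; exact hwb j hj
    have h2 : (F a w).natAbs ≤ A := by
      apply Nat.le_floor
      rwa [Nat.cast_natAbs, Int.cast_abs]
    rw [Finset.mem_Icc]
    omega
  have hmapsB : ∀ a ∈ Fintype.piFinset (fun _ : Fin (n + 1) => Finset.range (H + 1)),
      F a z / u ∈ Finset.Icc (-(B : ℤ)) B := fun a ha => by
    have h1 := hFb a ha z _ hzb
    have huR : 0 < |(u : ℝ)| := abs_pos.mpr (by exact_mod_cast hu0)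
    have h2 : |((F a z / u : ℤ) : ℝ)| * |(u : ℝ)| ≤ |(F a z : ℝ)| + |(u : ℝ)| := by
      have e1 : (u : ℝ) * ((F a z / u : ℤ) : ℝ) + ((F a z % u : ℤ) : ℝ) = F a z := by
        exact_mod_cast Int.mul_ediv_add_emod (F a z) u
      have e2 : |((F a z % u : ℤ) : ℝ)| ≤ |(u : ℝ)| := by
        rw [← Int.cast_abs, ← Int.cast_abs, Int.cast_le, abs_of_nonneg (Int.emod_nonneg _ hu0)]
        exact (Int.emod_lt_abs _ hu0).le
      rw [← abs_mul]
      have e3 : ((F a z / u : ℤ) : ℝ) * u = F a z - ((F a z % u : ℤ) : ℝ) := by linarith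
      rw [e3]
      exact (abs_sub _ _).trans (by linarith)
    have h3 : (F a z / u).natAbs ≤ B := by
      apply Nat.le_floor
      rw [Nat.cast_natAbs, Int.cast_abs]
      refine le_of_mul_le_mul_right (h2.trans ?_) huR
      have e4 : |(z 0 : ℝ)| = |(u : ℝ)| * g := by
        rw [hu]; push_cast; rw [abs_mul, abs_of_pos hgR]
      rw [e4] at h1
      linarith
    rw [Finset.mem_Icc]
    omega
  have hcard : (Finset.Icc (-(A : ℤ)) A ×ˢ Finset.Icc (-(B : ℤ)) B).card <
      (Fintype.piFinset (fun _ : Fin (n + 1) => Finset.range (H + 1))).card := by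
    rw [Finset.card_product, Int.card_Icc, Int.card_Icc, Fintype.card_piFinset_const,
      Finset.card_range]
    have c1 : ((A : ℤ) + 1 - -(A : ℤ)).toNat = 2 * A + 1 := by omega
    have c2 : ((B : ℤ) + 1 - -(B : ℤ)).toNat = 2 * B + 1 := by omega
    rw [c1, c2]
    have hAle : (A : ℝ) ≤ (n + 1) * (H * (2 * Y / g)) := Nat.floor_le (by positivity)
    have hBle : (B : ℝ) ≤ (n + 1) * (H * (M * g)) + 1 := Nat.floor_le (by positivity)
    have hnH : 1 ≤ ((n : ℝ) + 1) * H := one_le_mul_of_one_le_of_one_le (by linarith) hH1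
    have hA1 : 1 ≤ ((n : ℝ) + 1) * (H * (2 * Y / g)) := by
      rw [← mul_assoc]
      exact one_le_mul_of_one_le_of_one_le hnH ((one_le_div hgR).mpr hgY)
    have hB1 : 1 ≤ ((n : ℝ) + 1) * (H * (M * g)) := by
      rw [← mul_assoc]
      exact one_le_mul_of_one_le_of_one_le hnH (one_le_mul_of_one_le_of_one_le hM1 hg1)
    have hA' : (2 * (A : ℝ) + 1) ≤ 4 * ((n + 1) * (H * (2 * Y / g))) := by linarith
    have hB' : (2 * (B : ℝ) + 1) ≤ 5 * ((n + 1) * (H * (M * g))) := by linarith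
    have hprod : (2 * (A : ℝ) + 1) * (2 * B + 1) ≤ (H : ℝ) ^ 2 * (D * Y) := by
      refine (mul_le_mul hA' hB' (by positivity) (by positivity)).trans_eq ?_
      rw [hD]
      field_simp
      ring
    have hpow : D * Y ≤ (H : ℝ) ^ (n - 1) := by
      have h1 : ((D * Y) ^ s) ^ (n - 1) = D * Y := by
        rw [← Real.rpow_natCast, ← Real.rpow_mul (by linarith), Nat.cast_sub (by omega),
          Nat.cast_one, hs, one_div, inv_mul_cancel₀ (by linarith), Real.rpow_one]
      rw [← h1]
      exact pow_le_pow_left₀ (by linarith) hHge _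
    have hfin : (2 * (A : ℝ) + 1) * (2 * B + 1) < ((H : ℝ) + 1) ^ (n + 1) := by
      calc (2 * (A : ℝ) + 1) * (2 * B + 1) ≤ (H : ℝ) ^ 2 * (H : ℝ) ^ (n - 1) :=
            hprod.trans (by gcongr)
        _ = (H : ℝ) ^ (n + 1) := by rw [← pow_add]; congr 1; omega
        _ < _ := pow_lt_pow_left₀ (by linarith) (by linarith) (by omega)
    exact_mod_cast hfin
  obtain ⟨a, ha, b, hb, hab, heq⟩ := Finset.exists_ne_map_eq_of_card_lt_of_maps_to hcard
    (f := fun a => (F a w, F a z / u)) fun a ha =>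
      Finset.mem_product.mpr ⟨hmapsA a ha, hmapsB a ha⟩
  obtain ⟨hew, hez⟩ := Prod.mk.inj heq
  set p : ℕ → ℤ := fun j => if h : j < n + 1 then (a ⟨j, h⟩ : ℤ) - b ⟨j, h⟩ else 0 with hp
  have hpF : ∀ y : ℕ → ℤ, ∑ j ∈ Finset.range (n + 1), p j * y j = F a y - F b y := fun y => by
    rw [Finset.sum_range, hF]
    simp only
    rw [← Finset.sum_sub_distrib]
    refine Finset.sum_congr rfl fun i _ => ?_
    simp only [hp, i.2, dif_pos, sub_mul]
  refine ⟨p, ?_, ?_, fun j hj => ?_⟩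
  · obtain ⟨i, hi⟩ := Function.ne_iff.mp hab
    refine ⟨i, by omega, ?_⟩
    have hin : (i : ℕ) ≤ n := by omega
    simpa [hp, hin, sub_eq_zero] using hi
  · have h1 : u' * (F a z - F b z) = u * (F a z' - F b z') := by
      have : u' * (F a z - F b z) - u * (F a z' - F b z') = F a w - F b w := by
        rw [← hpF, ← hpF, ← hpF, Finset.mul_sum, Finset.mul_sum, ← Finset.sum_sub_distrib]
        exact Finset.sum_congr rfl fun j _ => by simp only [hw]; ring
      rw [hew, sub_self] at this
      linarith
    have h2 : u ∣ F a z - F b z :=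
      (Int.isCoprime_iff_gcd_eq_one.mpr hcop).dvd_of_dvd_mul_left ⟨_, h1⟩
    rw [hpF]
    -- Equal quotients by `u` leave a difference of absolute value below `|u|`, and this difference
    -- is divisible by `u`.
    refine Int.eq_zero_of_abs_lt_dvd ((abs_dvd u _).mpr h2) ?_
    have e1 := Int.mul_ediv_add_emod (F a z) u
    have e2 := Int.mul_ediv_add_emod (F b z) u
    rw [hez] at e1
    have e3 := Int.emod_nonneg (F a z) hu0
    have e4 := Int.emod_nonneg (F b z) hu0
    have e5 := Int.emod_lt_abs (F a z) hu0
    have e6 := Int.emod_lt_abs (F b z) hu0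
    rw [abs_lt]
    constructor <;> linarith
  · refine le_trans ?_ hHle
    have h1 := Fintype.mem_piFinset.mp ha ⟨j, by omega⟩
    have h2 := Fintype.mem_piFinset.mp hb ⟨j, by omega⟩
    rw [Finset.mem_range] at h1 h2
    have h3 : |p j| ≤ (H : ℤ) := by
      simp only [hp, show j < n + 1 by omega, dif_pos]
      rw [abs_le]
      omega
    exact_mod_cast h3

/-! ### The two lower bounds -/

/-- The data used for the lower bounds of `lambdaExp`: an independent pair of approximations and a
small polynomial that almost vanishes at `ξ`. -/
lemma exists_pair_and_polynomial {n : ℕ} (hn : 2 ≤ n) {ξ lam mu : ℝ} (hξ : Irrational ξ)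
    (hlam : 0 < lam) (hmulam : mu ≤ lam)
    (h : ∃ᶠ X : ℝ in atTop, SimApproxSolvable (veronese n ξ) lam X)
    (hmu : ∀ᶠ X : ℝ in atTop, SimApproxSolvable (veronese n ξ) mu X) :
    ∃ τ K C : ℝ, 0 ≤ τ ∧ 0 ≤ K ∧ 1 ≤ C ∧ ∀ B : ℝ,
      ∃ (z z' p : ℕ → ℤ) (t q : ℤ) (δ : ℝ), B ≤ |(z 0 : ℝ)| ∧ 1 ≤ |(z 0 : ℝ)| ∧
        |(z' 0 : ℝ)| ≤ |(z 0 : ℝ)| ∧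
        (∀ j ≤ n, |(z j : ℝ) - z 0 * ξ ^ j| ≤ |(z 0 : ℝ)| ^ (-lam)) ∧
        (∀ j ≤ n, |(z' j : ℝ) - z' 0 * ξ ^ j| ≤ C * |(z 0 : ℝ)| ^ (-mu)) ∧
        (∀ α β : ℤ, (∀ j ≤ n, α * z j + β * z' j = 0) → α = 0 ∧ β = 0) ∧
        |(t : ℝ)| ≤ τ ∧ 1 ≤ |ξ - t| ∧ (∀ j ≤ n, |(p j : ℝ)| ≤ K * |(q : ℝ)|) ∧
        coeffPair n p (fun i => (t : ℝ) ^ i) = q ∧ q ≠ 0 ∧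
        |coeffPair n p (fun i => ξ ^ i)| ≤ δ * |(q : ℝ)| ∧ 0 ≤ δ ∧
        δ * |(z 0 : ℝ)| ≤ C * |(z 0 : ℝ)| ^ (-lam) ∧
        |(q : ℝ)| ≤ C * |(z 0 : ℝ)| ^ ((1 - mu) / ((n : ℝ) - 1)) := by
  obtain ⟨τ, K, hτ, hK, heval⟩ := exists_int_eval_large n ξ
  obtain ⟨C₁, hC₁, hann⟩ := exists_small_annihilator hn ξ
  -- The exponent `mu` may be negative; the maximum with `1` keeps the error bound of `z'` above
  -- that of `z`.
  set c : ℝ := max 1 (2 ^ mu) with hc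
  have hc1 : 1 ≤ c := le_max_left _ _
  set s : ℝ := 1 / ((n : ℝ) - 1) with hs
  have hs0 : 0 ≤ s := by
    have : (2 : ℝ) ≤ n := by exact_mod_cast hn
    rw [hs]
    apply one_div_nonneg.mpr
    linarith
  have hcs0 : 0 ≤ c ^ s := Real.rpow_nonneg (by linarith) _
  refine ⟨τ, K, c + (n + 1) * K + K * (C₁ * c ^ s), hτ, by linarith, ?_, fun B => ?_⟩
  · have : 0 ≤ (n + 1) * K + K * (C₁ * c ^ s) := by positivity
    linarith
  obtain ⟨z, z', hBz, hz1, hzz', hz, hz', j₀, hj₀, hne⟩ :=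
    exists_independent_pair (by omega : 1 ≤ n) hξ hlam h hmu B
  set Y : ℝ := |(z 0 : ℝ)| with hY
  have hY0 : 0 < Y := by linarith
  have hE0 : 0 < Y ^ (-lam) := Real.rpow_pos_of_pos hY0 _
  have hE'0 : 0 < Y ^ (-mu) := Real.rpow_pos_of_pos hY0 _
  have hE1 : Y ^ (-lam) ≤ 1 := Real.rpow_le_one_of_one_le_of_nonpos hz1 (by linarith)
  have hEE : Y ^ (-lam) ≤ Y ^ (-mu) := Real.rpow_le_rpow_of_exponent_le hz1 (by linarith)
  have hz'c : ∀ j ≤ n, |(z' j : ℝ) - z' 0 * ξ ^ j| ≤ c * Y ^ (-mu) := fun j hj =>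
    (hz' j hj).trans (mul_le_mul_of_nonneg_right (le_max_right _ _) hE'0.le)
  obtain ⟨p, hp0, hpz, hpb⟩ := hann z z' (Y ^ (-lam)) (c * Y ^ (-mu)) hz1 hzz' hE1
    (by nlinarith) hz hz'c ⟨j₀, hj₀, hne⟩
  obtain ⟨t, q, htτ, hξt, hq, hq0, hpq, hH⟩ := heval p hp0
  have hqR : 0 < |(q : ℝ)| := abs_pos.mpr (by exact_mod_cast hq0)
  refine ⟨z, z', p, t, q, (n + 1) * K * Y ^ (-lam) / Y, hBz, hz1, hzz', hz,
    fun j hj => (hz'c j hj).trans ?_, fun α β hαβ => ?_, htτ, hξt, hpq, hq, hq0, ?_,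
    by positivity, ?_, ?_⟩
  · have : 0 ≤ (n + 1) * K + K * (C₁ * c ^ s) := by positivity
    gcongr
    linarith
  · have e0 := hαβ 0 (by omega)
    have ej := hαβ j₀ hj₀
    have hne' : z' 0 * z j₀ - z 0 * z' j₀ ≠ 0 := sub_ne_zero.mpr hne
    have ha : α * (z' 0 * z j₀ - z 0 * z' j₀) = 0 := by linear_combination z' 0 * ej - z' j₀ * e0
    have hb : β * (z' 0 * z j₀ - z 0 * z' j₀) = 0 := by linear_combination z j₀ * e0 - z 0 * ej
    exact ⟨(mul_eq_zero.mp ha).resolve_right hne', (mul_eq_zero.mp hb).resolve_right hne'⟩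
  · have h1 : coeffPair n p (fun i => (z i : ℝ)) = 0 := by
      rw [coeffPair]
      exact_mod_cast hpz
    -- As `p` annihilates `z`, its value at `ξ` comes only from the errors of `z`, divided by `z 0`.
    have h2 : (z 0 : ℝ) * coeffPair n p (fun i => ξ ^ i) =
        -coeffPair n p ((fun i => (z i : ℝ)) - fun i => (z 0 : ℝ) * ξ ^ i) := by
      rw [coeffPair_sub, h1, coeffPair_mul_left]
      ring
    have h3 : Y * |coeffPair n p (fun i => ξ ^ i)| ≤ (n + 1) * (K * |(q : ℝ)| * Y ^ (-lam)) := by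
      rw [hY, ← abs_mul, h2, abs_neg]
      exact abs_coeffPair_le (by positivity) hpq hz
    rw [div_mul_eq_mul_div, le_div_iff₀ hY0]
    linarith
  · rw [div_mul_cancel₀ _ hY0.ne']
    have : 0 ≤ K * (C₁ * c ^ s) := by positivity
    gcongr
    linarith
  · have h1 : (Y * (c * Y ^ (-mu))) ^ s = c ^ s * Y ^ ((1 - mu) / ((n : ℝ) - 1)) := by
      have : Y * (c * Y ^ (-mu)) = c * Y ^ (1 - mu) := by
        rw [sub_eq_add_neg, Real.rpow_add hY0, Real.rpow_one]; ring
      rw [this, Real.mul_rpow (by linarith) (Real.rpow_nonneg hY0.le _), ← Real.rpow_mul hY0.le, hs,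
        mul_one_div]
    have h2 := hH _ hpb
    rw [h1] at h2
    have h3 : 0 < Y ^ ((1 - mu) / ((n : ℝ) - 1)) := Real.rpow_pos_of_pos hY0 _
    refine h2.trans ?_
    rw [← mul_assoc, ← mul_assoc, ← mul_assoc] at *
    have : 0 ≤ (n + 1) * K := by positivity
    gcongr
    linarith

lemma natAbs_pow_le {q : ℤ} {C Y h : ℝ} (hY : 0 < Y) (hq : |(q : ℝ)| ≤ C * Y ^ h) (m : ℕ) :
    ((q.natAbs ^ m : ℕ) : ℝ) ≤ C ^ m * Y ^ (m * h) := by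
  rw [mul_comm (m : ℝ), Real.rpow_mul hY.le, Real.rpow_natCast, ← mul_pow, Nat.cast_pow,
    Nat.cast_natAbs, Int.cast_abs]
  exact pow_le_pow_left₀ (abs_nonneg _) hq m

/-- First lower bound, in terms of `h = (1 - mu) / (n - 1)`. -/
lemma first_bound_le_lambdaExp {n m : ℕ} (hn : 2 ≤ n) {ξ lam mu : ℝ} (hξ : Irrational ξ)
    (hlam : 0 < lam) (hmulam : mu ≤ lam)
    (h : ∃ᶠ X : ℝ in atTop, SimApproxSolvable (veronese n ξ) lam X)
    (hmu : ∀ᶠ X : ℝ in atTop, SimApproxSolvable (veronese n ξ) mu X) :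
    (((lam - m * ((1 - mu) / ((n : ℝ) - 1))) / (1 + m * ((1 - mu) / ((n : ℝ) - 1))) : ℝ) : EReal)
      ≤ lambdaExp (n + m) ξ := by
  obtain ⟨τ, K, C₀, hτ, hK, hC₀, hdata⟩ := exists_pair_and_polynomial hn hξ hlam hmulam h hmu
  obtain ⟨C, hC, hext⟩ := exists_int_extension n m τ K hτ hK
  set η : ℝ := (1 - mu) / ((n : ℝ) - 1) with hη
  have hη0 : 0 ≤ η := by
    have h1 : (2 : ℝ) ≤ n := by exact_mod_cast hn
    have h2 := le_one_of_eventually_simApproxSolvable (by omega : 1 ≤ n) hξ hmu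
    exact div_nonneg (by linarith) (by linarith)
  have hC₀m : 1 ≤ C₀ ^ m := one_le_pow₀ hC₀
  refine div_le_lambdaExp (C := C * C₀ ^ m * (1 + C₀)) (by positivity)
    (one_le_mul_of_one_le_of_one_le (one_le_mul_of_one_le_of_one_le hC hC₀m) (by linarith)) ?_
  intro B
  obtain ⟨z, z', p, t, q, δ, hBz, hz1, hzz', hz, hz', hind, ht, hξt, hp, hq, hq0, hδ, hδ0, hδz,
    hqb⟩ := hdata B
  -- With `T = 0` only multiples of `z` enter.
  obtain ⟨v, x, hv, hx, hvx⟩ := hext ξ δ _ _ p t q z z' (q.natAbs ^ m) 0 ht hξt hp hq hq0 hδ hz hz'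
    (fun α β _ _ hαβ => hind α β hαβ) (by simp)
  set Y : ℝ := |(z 0 : ℝ)| with hY
  have hY0 : 0 < Y := by linarith
  have hS := natAbs_pow_le hY0 hqb m
  have hYm : 0 < Y ^ (m * η) := Real.rpow_pos_of_pos hY0 _
  have hE0 : 0 < Y ^ (-lam) := Real.rpow_pos_of_pos hY0 _
  refine ⟨Y, hBz, v, x, hv, hx.trans ?_, fun j hj => (hvx j hj).trans ?_⟩
  · rw [Real.rpow_add hY0, Real.rpow_one]
    calc ((q.natAbs ^ m : ℕ) : ℝ) * Y + (0 : ℕ) * |(z' 0 : ℝ)| ≤ (C₀ ^ m * Y ^ (m * η)) * Y := by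
          rw [Nat.cast_zero, zero_mul, add_zero]
          gcongr
      _ = 1 * C₀ ^ m * 1 * (Y * Y ^ (m * η)) := by ring
      _ ≤ C * C₀ ^ m * (1 + C₀) * (Y * Y ^ (m * η)) := by
          gcongr
          linarith
  · have hYb : Y ^ (-(lam - m * η)) = Y ^ (m * η) * Y ^ (-lam) := by
      rw [← Real.rpow_add hY0]; congr 1; ring
    rw [hYb]
    calc C * (((q.natAbs ^ m : ℕ) : ℝ) * Y ^ (-lam) + (0 : ℕ) * (C₀ * Y ^ (-mu)) +
          δ * (((q.natAbs ^ m : ℕ) : ℝ) * Y + (0 : ℕ) * |(z' 0 : ℝ)|))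
        = C * (((q.natAbs ^ m : ℕ) : ℝ) * (Y ^ (-lam) + δ * Y)) := by
          rw [Nat.cast_zero]; ring
      _ ≤ C * ((C₀ ^ m * Y ^ (m * η)) * (Y ^ (-lam) + C₀ * Y ^ (-lam))) := by
          gcongr
      _ = _ := by ring

/-- Second lower bound, in terms of `h = (1 - mu) / (n - 1)`. -/
lemma second_bound_le_lambdaExp {n m : ℕ} (hn : 2 ≤ n) {ξ lam mu : ℝ} (hξ : Irrational ξ)
    (hlam : 0 < lam) (hmulam : mu ≤ lam)
    (h : ∃ᶠ X : ℝ in atTop, SimApproxSolvable (veronese n ξ) lam X)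
    (hmu : ∀ᶠ X : ℝ in atTop, SimApproxSolvable (veronese n ξ) mu X) :
    ((((lam + mu - m * ((1 - mu) / ((n : ℝ) - 1))) / 2) /
      (1 + (m * ((1 - mu) / ((n : ℝ) - 1)) + lam - mu) / 2) : ℝ) : EReal)
      ≤ lambdaExp (n + m) ξ := by
  obtain ⟨τ, K, C₀, hτ, hK, hC₀, hdata⟩ := exists_pair_and_polynomial hn hξ hlam hmulam h hmu
  obtain ⟨C, hC, hext⟩ := exists_int_extension n m τ K hτ hK
  set η : ℝ := (1 - mu) / ((n : ℝ) - 1) with hη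
  have hη0 : 0 ≤ η := by
    have h1 : (2 : ℝ) ≤ n := by exact_mod_cast hn
    have h2 := le_one_of_eventually_simApproxSolvable (by omega : 1 ≤ n) hξ hmu
    exact div_nonneg (by linarith) (by linarith)
  have hmη : 0 ≤ m * η := by positivity
  have hC₀m : 1 ≤ C₀ ^ m := one_le_pow₀ hC₀
  refine div_le_lambdaExp (C := C * C₀ ^ m * (4 * C₀)) (by linarith)
    (one_le_mul_of_one_le_of_one_le (one_le_mul_of_one_le_of_one_le hC hC₀m) (by linarith)) ?_
  intro B
  obtain ⟨z, z', p, t, q, δ, hBz, hz1, hzz', hz, hz', hind, ht, hξt, hp, hq, hq0, hδ, hδ0, hδz,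
    hqb⟩ := hdata B
  set Y : ℝ := |(z 0 : ℝ)| with hY
  have hY0 : 0 < Y := by linarith
  -- The box sides are chosen so that `σ * ρ` dominates `|q| ^ m` and the errors balance: `σ * Y ^
  -- (-lam) = ρ * Y ^ (-mu)`.
  set σ : ℝ := C₀ ^ m * Y ^ ((m * η + lam - mu) / 2) with hσ
  set ρ : ℝ := C₀ ^ m * Y ^ ((m * η - lam + mu) / 2) with hρ
  have hσ0 : 0 < σ := mul_pos (by positivity) (Real.rpow_pos_of_pos hY0 _)
  have hρ0 : 0 < ρ := mul_pos (by positivity) (Real.rpow_pos_of_pos hY0 _)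
  have hρσ : ρ ≤ σ := mul_le_mul_of_nonneg_left
    (Real.rpow_le_rpow_of_exponent_le hz1 (by linarith)) (by linarith)
  have hcard : q.natAbs ^ m < (⌊σ⌋₊ + 1) * (⌊ρ⌋₊ + 1) := by
    have h1 : σ * ρ < (⌊σ⌋₊ + 1 : ℝ) * (⌊ρ⌋₊ + 1 : ℝ) :=
      mul_lt_mul'' (Nat.lt_floor_add_one _) (Nat.lt_floor_add_one _) hσ0.le hρ0.le
    have h2 : σ * ρ = C₀ ^ m * (C₀ ^ m * Y ^ (m * η)) := by
      have : Y ^ (m * η) = Y ^ ((m * η + lam - mu) / 2) * Y ^ ((m * η - lam + mu) / 2) := by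
        rw [← Real.rpow_add hY0]; congr 1; ring
      rw [hσ, hρ, this]
      ring
    have h3 := natAbs_pow_le hY0 hqb m
    have h4 : C₀ ^ m * Y ^ (m * η) ≤ C₀ ^ m * (C₀ ^ m * Y ^ (m * η)) :=
      le_mul_of_one_le_left (mul_nonneg (by positivity) (Real.rpow_nonneg hY0.le _)) hC₀m
    have h5 : ((q.natAbs ^ m : ℕ) : ℝ) < (⌊σ⌋₊ + 1 : ℝ) * (⌊ρ⌋₊ + 1 : ℝ) := by linarith
    exact_mod_cast h5
  obtain ⟨v, x, hv, hx, hvx⟩ := hext ξ δ _ _ p t q z z' ⌊σ⌋₊ ⌊ρ⌋₊ ht hξt hp hq hq0 hδ hz hz'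
    (fun α β _ _ hαβ => hind α β hαβ) hcard
  have hS : (⌊σ⌋₊ : ℝ) ≤ σ := Nat.floor_le hσ0.le
  have hT : (⌊ρ⌋₊ : ℝ) ≤ ρ := Nat.floor_le hρ0.le
  have hE0 : 0 < Y ^ (-lam) := Real.rpow_pos_of_pos hY0 _
  have hE'0 : 0 < Y ^ (-mu) := Real.rpow_pos_of_pos hY0 _
  have hU : (⌊σ⌋₊ : ℝ) * Y + ⌊ρ⌋₊ * |(z' 0 : ℝ)| ≤ 2 * σ * Y := by
    calc (⌊σ⌋₊ : ℝ) * Y + ⌊ρ⌋₊ * |(z' 0 : ℝ)| ≤ σ * Y + σ * Y := by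
          have := hT.trans hρσ
          gcongr
      _ = _ := by ring
  refine ⟨Y, hBz, v, x, hv, hx.trans (hU.trans ?_), fun j hj => (hvx j hj).trans ?_⟩
  · rw [Real.rpow_add hY0, Real.rpow_one, hσ]
    have h1 : 0 < Y ^ ((m * η + lam - mu) / 2) := Real.rpow_pos_of_pos hY0 _
    calc 2 * (C₀ ^ m * Y ^ ((m * η + lam - mu) / 2)) * Y
        = 1 * C₀ ^ m * 2 * (Y * Y ^ ((m * η + lam - mu) / 2)) := by ring
      _ ≤ C * C₀ ^ m * (4 * C₀) * (Y * Y ^ ((m * η + lam - mu) / 2)) := by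
          gcongr
          linarith
  · set W : ℝ := C₀ ^ m * Y ^ (-((lam + mu - m * η) / 2)) with hW
    have hW0 : 0 < W := mul_pos (by positivity) (Real.rpow_pos_of_pos hY0 _)
    have h1 : σ * Y ^ (-lam) = W := by
      rw [hσ, hW, mul_assoc, ← Real.rpow_add hY0]; congr 2; ring
    have h2 : ρ * Y ^ (-mu) = W := by
      rw [hρ, hW, mul_assoc, ← Real.rpow_add hY0]; congr 2; ring
    have h3 : δ * (⌊σ⌋₊ * Y + ⌊ρ⌋₊ * |(z' 0 : ℝ)|) ≤ 2 * C₀ * W := by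
      calc δ * (⌊σ⌋₊ * Y + ⌊ρ⌋₊ * |(z' 0 : ℝ)|) ≤ δ * (2 * σ * Y) := by gcongr
        _ = 2 * σ * (δ * Y) := by ring
        _ ≤ 2 * σ * (C₀ * Y ^ (-lam)) := by gcongr
        _ = 2 * C₀ * (σ * Y ^ (-lam)) := by ring
        _ = 2 * C₀ * W := by rw [h1]
    calc C * (⌊σ⌋₊ * Y ^ (-lam) + ⌊ρ⌋₊ * (C₀ * Y ^ (-mu)) +
          δ * (⌊σ⌋₊ * Y + ⌊ρ⌋₊ * |(z' 0 : ℝ)|))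
        ≤ C * (σ * Y ^ (-lam) + ρ * (C₀ * Y ^ (-mu)) + 2 * C₀ * W) := by gcongr
      _ = C * (W + C₀ * W + 2 * C₀ * W) := by rw [mul_left_comm ρ, h1, h2]
      _ ≤ C * (C₀ * W + C₀ * W + 2 * C₀ * W) := by
          gcongr
          exact le_mul_of_one_le_left hW0.le hC₀
      _ = C * C₀ ^ m * (4 * C₀) * Y ^ (-((lam + mu - m * η) / 2)) := by rw [hW]; ring

/-! ### Infinite exponents, limits and the final statement -/

/-- The bound `(lam - m) / (1 + m)` from linear polynomials is unbounded in `lam`. -/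
lemma lambdaExp_eq_top_of_le {n k : ℕ} (hn : 1 ≤ n) (hnk : n ≤ k) {ξ : ℝ}
    (h : lambdaExp n ξ = ⊤) : lambdaExp k ξ = ⊤ := by
  obtain ⟨m, rfl⟩ := Nat.exists_eq_add_of_le hnk
  refine EReal.eq_top_iff_forall_lt _ |>.mpr fun c => ?_
  set lam : ℝ := max 1 ((c + 1) * (1 + m) + m) with hlam
  have hm : (0 : ℝ) < 1 + m := by positivity
  refine lt_of_lt_of_le (EReal.coe_lt_coe_iff.mpr ?_) (sub_div_le_lambdaExp (m := m) hn
    (lt_of_lt_of_le one_pos (le_max_left _ _) : 0 < lam)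
    (frequently_of_coe_lt_lambdaExp (h ▸ EReal.coe_lt_top lam)))
  rw [lt_div_iff₀ hm]
  have : (c + 1) * (1 + m) + m ≤ lam := le_max_right _ _
  linarith

/-- A bound that is continuous in the exponents persists for the exponents themselves. -/
lemma apply_zero_le_of_forall_pos_lt {f : ℝ → ℝ} {c b : ℝ} (hc : 0 < c) (hf : ContinuousAt f 0)
    (h : ∀ ε, 0 < ε → ε < c → f ε ≤ b) : f 0 ≤ b :=
  le_of_tendsto (hf.tendsto.mono_left nhdsWithin_le_nhds : Tendsto f (nhdsWithin 0 (Set.Ioi 0)) _)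
    (Filter.mem_of_superset (Ioo_mem_nhdsGT hc) fun ε hε => h ε hε.1 hε.2)

theorem mainTheorem1 (n k : ℕ) (hn : 1 ≤ n) (hnk : n ≤ k) (ξ : ℝ) :
    (lambdaExp n ξ = ⊤ → lambdaExp k ξ = ⊤) ∧
    (lambdaExp n ξ ≠ ⊤ →
      ∃ ln lhn lk : ℝ,
        lambdaExp n ξ = (ln : EReal) ∧ lambdaHatExp n ξ = (lhn : EReal) ∧
        lambdaExp k ξ = (lk : EReal) ∧
        -- the two lower bounds, with positive denominators
        (2 ≤ n →
          0 < ((n : ℝ) - k) * lhn + k - 1 ∧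
          lk ≥ (((n : ℝ) - 1) * ln + ((k : ℝ) - n) * lhn + n - k) /
                (((n : ℝ) - k) * lhn + k - 1) ∧
          0 < ((n : ℝ) - 1) * ln - ((k : ℝ) - 1) * lhn + n + k - 2 ∧
          lk ≥ (((n : ℝ) - 1) * ln + ((k : ℝ) - 1) * lhn + n - k) /
                (((n : ℝ) - 1) * ln - ((k : ℝ) - 1) * lhn + n + k - 2)) ∧
        -- for `n = 1` both quotients are `0 / 0`, because the uniform exponent is `1`
        (n = 1 → lhn = 1) ∧
        -- the form of the first bound when the uniform exponent is `1 / n`, also for `n = 1`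
        (lhn = 1 / (n : ℝ) → lk ≥ ((n : ℝ) * ln + n - k) / k)) := by
  refine ⟨lambdaExp_eq_top_of_le hn hnk, fun hne => ?_⟩
  have hξ : Irrational ξ := by
    by_contra hrat
    exact hne (lambdaExp_eq_top_of_not_irrational hrat)
  have real_of {e : EReal} (h0 : 0 ≤ e) (h1 : e ≠ ⊤) : ∃ r : ℝ, e = r :=
    ⟨e.toReal, (EReal.coe_toReal h1 (lt_of_lt_of_le EReal.bot_lt_zero h0).ne').symm⟩
  have hhat := lambdaHatExp_le_lambdaExp n ξ
  have hk0 := (lambdaHatExp_nonneg k ξ).trans (lambdaHatExp_le_lambdaExp k ξ)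
  obtain ⟨ln, hln⟩ := real_of ((lambdaHatExp_nonneg n ξ).trans hhat) hne
  obtain ⟨lhn, hlhn⟩ := real_of (lambdaHatExp_nonneg n ξ) (ne_top_of_le_ne_top hne hhat)
  obtain ⟨lk, hlk⟩ := real_of hk0 (ne_top_of_le_ne_top hne (lambdaExp_anti hnk ξ))
  have hlhn0 : 0 ≤ lhn := by
    have := lambdaHatExp_nonneg n ξ
    rw [hlhn] at this
    exact_mod_cast this
  have hlhn1 : lhn ≤ 1 := by
    have := lambdaHatExp_le_one hn hξ
    rw [hlhn] at this
    exact EReal.coe_le_coe_iff.mp this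
  have hle : lhn ≤ ln := by
    rw [hln, hlhn] at hhat
    exact EReal.coe_le_coe_iff.mp hhat
  have hlk0 : 0 ≤ lk := by
    rw [hlk] at hk0
    exact_mod_cast hk0
  have hfreq : ∀ ε, 0 < ε →
      ∃ᶠ X : ℝ in atTop, SimApproxSolvable (veronese n ξ) (ln - ε) X := fun ε hε =>
    frequently_of_coe_lt_lambdaExp (by rw [hln]; exact EReal.coe_lt_coe_iff.mpr (by linarith))
  have hev : ∀ ε, 0 < ε →
      ∀ᶠ X : ℝ in atTop, SimApproxSolvable (veronese n ξ) (lhn - ε) X := fun ε hε =>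
    eventually_of_coe_lt_lambdaHatExp (by rw [hlhn]; exact EReal.coe_lt_coe_iff.mpr (by linarith))
  have hhat1 : n = 1 → lhn = 1 := by
    rintro rfl
    have := one_le_lambdaHatExp_one ξ
    rw [hlhn] at this
    exact le_antisymm hlhn1 (EReal.coe_le_coe_iff.mp this)
  obtain ⟨m, rfl⟩ := Nat.exists_eq_add_of_le hnk
  have hm0 : (0 : ℝ) ≤ m := by positivity
  have hbounds : 2 ≤ n →
      0 < ((n : ℝ) - (n + m : ℕ)) * lhn + (n + m : ℕ) - 1 ∧
      lk ≥ (((n : ℝ) - 1) * ln + (((n + m : ℕ) : ℝ) - n) * lhn + n - (n + m : ℕ)) /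
            (((n : ℝ) - (n + m : ℕ)) * lhn + (n + m : ℕ) - 1) ∧
      0 < ((n : ℝ) - 1) * ln - (((n + m : ℕ) : ℝ) - 1) * lhn + n + (n + m : ℕ) - 2 ∧
      lk ≥ (((n : ℝ) - 1) * ln + (((n + m : ℕ) : ℝ) - 1) * lhn + n - (n + m : ℕ)) /
            (((n : ℝ) - 1) * ln - (((n + m : ℕ) : ℝ) - 1) * lhn + n + (n + m : ℕ) - 2) := by
    intro hn2
    have hn1 : (0 : ℝ) < (n : ℝ) - 1 := by
      have : (2 : ℝ) ≤ n := by exact_mod_cast hn2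
      linarith
    set η : ℝ := (1 - lhn) / ((n : ℝ) - 1) with hη
    have hη0 : 0 ≤ η := div_nonneg (by linarith) hn1.le
    have hηn : ((n : ℝ) - 1) * η = 1 - lhn := mul_div_cancel₀ _ hn1.ne'
    have hmη : 0 ≤ m * η := by positivity
    -- Substituting `(n - 1) * η = 1 - lhn` turns the stated quotients into those in terms of `η`,
    -- up to a common factor `n - 1` or `2 * (n - 1)`; positivity of the denominators is then
    -- visible.
    have hd1 : ((n : ℝ) - (n + m : ℕ)) * lhn + (n + m : ℕ) - 1 = ((n : ℝ) - 1) * (1 + m * η) := by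
      push_cast
      linear_combination -(m : ℝ) * hηn
    have hd2 : ((n : ℝ) - 1) * ln - (((n + m : ℕ) : ℝ) - 1) * lhn + n + (n + m : ℕ) - 2 =
        (2 * ((n : ℝ) - 1)) * (1 + (m * η + ln - lhn) / 2) := by
      push_cast
      linear_combination -(m : ℝ) * hηn
    have hn1' : ((n : ℝ) - 1) * ln + (((n + m : ℕ) : ℝ) - n) * lhn + n - (n + m : ℕ) =
        ((n : ℝ) - 1) * (ln - m * η) := by
      push_cast
      linear_combination (m : ℝ) * hηn
    have hn2' : ((n : ℝ) - 1) * ln + (((n + m : ℕ) : ℝ) - 1) * lhn + n - (n + m : ℕ) =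
        (2 * ((n : ℝ) - 1)) * ((ln + lhn - m * η) / 2) := by
      push_cast
      linear_combination (m : ℝ) * hηn
    have hp1 : 0 < 1 + m * η := by linarith
    have hp2 : 0 < 1 + (m * η + ln - lhn) / 2 := by linarith
    rw [hd1, hd2, hn1', hn2', mul_div_mul_left _ _ hn1.ne',
      mul_div_mul_left _ _ (by linarith : 2 * ((n : ℝ) - 1) ≠ 0)]
    refine ⟨mul_pos hn1 hp1, ?_, mul_pos (by linarith) hp2, ?_⟩
    -- The approximation argument needs a positive `ln - ε`. If `ln = 0`, then `lhn = 0` as well and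
    -- the bound is not positive.
    · rcases (hlhn0.trans hle).eq_or_lt with hl | hl
      · exact (div_nonpos_of_nonpos_of_nonneg (by linarith) hp1.le).trans hlk0
      have := apply_zero_le_of_forall_pos_lt (b := lk) hl
        (f := fun ε => ((ln - ε) - m * ((1 - (lhn - ε)) / ((n : ℝ) - 1))) /
          (1 + m * ((1 - (lhn - ε)) / ((n : ℝ) - 1))))
        (ContinuousAt.div (by fun_prop) (by fun_prop) (by
          simp only [sub_zero]
          exact hp1.ne'))
        fun ε hε hεl => by
          have := first_bound_le_lambdaExp (m := m) hn2 hξ (by linarith : 0 < ln - ε)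
            (by linarith : lhn - ε ≤ ln - ε) (hfreq ε hε) (hev ε hε)
          rw [hlk] at this
          exact EReal.coe_le_coe_iff.mp this
      simpa only [sub_zero] using this
    · rcases (hlhn0.trans hle).eq_or_lt with hl | hl
      · exact (div_nonpos_of_nonpos_of_nonneg (by linarith) hp2.le).trans hlk0
      have := apply_zero_le_of_forall_pos_lt (b := lk) hl
        (f := fun ε => (((ln - ε) + (lhn - ε) - m * ((1 - (lhn - ε)) / ((n : ℝ) - 1))) / 2) /
          (1 + (m * ((1 - (lhn - ε)) / ((n : ℝ) - 1)) + (ln - ε) - (lhn - ε)) / 2))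
        (ContinuousAt.div (by fun_prop) (by fun_prop) (by
          simp only [sub_zero]
          exact hp2.ne'))
        fun ε hε hεl => by
          have := second_bound_le_lambdaExp (m := m) hn2 hξ (by linarith : 0 < ln - ε)
            (by linarith : lhn - ε ≤ ln - ε) (hfreq ε hε) (hev ε hε)
          rw [hlk] at this
          exact EReal.coe_le_coe_iff.mp this
      simpa only [sub_zero] using this
  refine ⟨ln, lhn, lk, hln, hlhn, hlk, hbounds, hhat1, fun hlhn' => ?_⟩
  -- For `n = 1` the linear polynomials give the bound; for `n ≥ 2` it is the first bound evaluated
  -- at `lhn = 1 / n`.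
  rcases hn.eq_or_lt with rfl | hn2
  · have := apply_zero_le_of_forall_pos_lt (b := lk) (c := ln) (by linarith [hhat1 rfl])
      (f := fun ε => ((ln - ε) - m) / (1 + m)) (by fun_prop) fun ε hε hεl => by
        have := sub_div_le_lambdaExp (m := m) le_rfl (by linarith : 0 < ln - ε) (hfreq ε hε)
        rw [hlk] at this
        exact EReal.coe_le_coe_iff.mp this
    push_cast
    convert this using 2
    ring
  · obtain ⟨hd, hb, -⟩ := hbounds hn2
    refine le_of_eq_of_le ?_ hb
    have hn0 : (0 : ℝ) < n := by positivity
    rw [div_eq_div_iff (by positivity) hd.ne', hlhn']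
    push_cast
    field_simp
    ring
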